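/- **Setting.** For natural numbers $n,u$, a *membership tester* $\mathcal M$ for universe $[u]$ and key size $n$ consists of two randomized algorithms with shared randomness $R$, where $R$ is independent of the key set: $\mathsf{Init}$ takes a key set $\mathcal K\subseteq[u]$ with $|\mathcal K|=n$ and returns a memory state $W$; $\mathsf{Query}$ takes $i\in[u]$ and $W$ and returns a score $\hat x_i\in[0,1]$. Both algorithms may read $R$ and use further private randomness. All testers are assumed permutation-invariant: for every permutation $\pi$ of $[u]$, every $\mathcal K$ and every $i$, $\mathsf{Query}(i,\mathsf{Init}(\mathcal K))$ and $\mathsf{Query}(\pi(i),\mathsf{Init}(\pi(\mathcal K)))$ have the same law. Hence the law of the answer to $i$ depends only on whether $i\in\mathcal K$; it is denoted $\mu_K(\mathcal M)$ for $i\in\mathcal K$ and $\mu_N(\mathcal M)$ for $i\notin\mathcal K$. The *memory budget* $B(\mathcal M)$ is the mutual information in bits between $\mathcal K$, drawn uniformly among the $n$-element subsets of $[u]$, and the memory state given the shared randomness, $B(\mathcal M)=I(W;\mathcal K\mid R)=I((R,W);\mathcal K)$; this is $I(W;\mathcal K)$ if there is no shared randomness or if $R$ is regarded as a part of $W$. Let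 $d^K,d^N:[0,1]\to[0,\infty]$ be lower semicontinuous with $d^K(1)=d^N(0)=0$ and such that $d^K(c)<\infty$ and $d^N(c)<\infty$ for some $c\in[0,1]$. The tester $\mathcal M$ *achieves error rates* $(a,b)$ if $\mathbb E_{\hat X\sim\mu_K(\mathcal M)}[d^K(\hat X)]\le a$ and $\mathbb E_{\hat X\sim\mu_N(\mathcal M)}[d^N(\hat X)]\le b$. For $\varepsilon\ge0$ let $\mathcal C_K(\varepsilon)$ (resp. $\mathcal C_N(\varepsilon)$) be the set of Borel probability measures $\mu$ on $[0,1]$ with $\mathbb E_{\hat X\sim\mu}[d^K(\hat X)]\le\varepsilon$ (resp. $\mathbb E_{\hat X\sim\mu}[d^N(\hat X)]\le\varepsilon$). $\mathrm{KL}$ is the Kullback–Leibler divergence with base-2 logarithm, with values in $[0,\infty]$. **Theorem.** Fix such $d^K,d^N$ and real numbers $\varepsilon_K,\varepsilon_N\ge0$. The minimum $$V=\min_{\mu_K\in\mathcal C_K(\varepsilon_K),\ \mu_N\in\mathcal C_N(\varepsilon_N)}\mathrm{KL}(\mu_K\,\|\,\mu_N)\in[0,\infty]$$ is attained. Let $n_j$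 be natural numbers and $u_j$ positive integers with $n_j\to\infty$ and $n_j/u_j\to0$, and for each $j$ let $\mathcal M_j$ be a membership tester for universe $[u_j]$ and key size $n_j$ that achieves error rates $(\varepsilon_{K,j},\varepsilon_{N,j})$, where $\limsup_j\varepsilon_{K,j}\le\varepsilon_K$ and $\limsup_j\varepsilon_{N,j}\le\varepsilon_N$. Then $$\liminf_{j\to\infty}\frac{B(\mathcal M_j)}{n_j}\ \ge\ V .$$ Moreover, there exist sequences $\{n_j\},\{u_j\},\{\mathcal M_j\}$ (and error rates) as above with $\lim_{j\to\infty}B(\mathcal M_j)/n_j=V$. -/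

import Mathlib

open MeasureTheory ProbabilityTheory Filter Topology
open scoped ENNReal NNReal

/-- The possible key sets: the subsets of `[u]` with exactly `n` elements. This finite
type carries the discrete σ-algebra. -/
abbrev KeySet (u n : ℕ) : Type := {s : Finset (Fin u) // s.card = n}

/-- The image `π(K)` of a key set under a permutation of the universe. -/
def KeySet.perm {u n : ℕ} (π : Equiv.Perm (Fin u)) (K : KeySet u n) : KeySet u n :=
  ⟨K.1.map π.toEmbedding, by rw [Finset.card_map]; exact K.2⟩

/-- Kullback-Leibler divergence in bits (base-2 logarithm), with values in `[0, ∞]`. -/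
noncomputable def klBits {α : Type*} [MeasurableSpace α] (μ ν : Measure α) : ℝ≥0∞ :=
  InformationTheory.klDiv μ ν / ENNReal.ofReal (Real.log 2)

/-- Mutual information in bits of the two coordinates under a joint law `γ`:
the divergence of the joint law from the product of its marginals. -/
noncomputable def mutualInfoBits {α β : Type*} [MeasurableSpace α] [MeasurableSpace β]
    (γ : Measure (α × β)) : ℝ≥0∞ :=
  klBits γ (γ.fst.prod γ.snd)

/-- A membership tester for universe `[u]` and key size `n`: two randomized algorithms with shared
randomness. The shared random string has law `rand` and is drawn independently of the key set.
`init K r` is the law of the memory state on key set `K` and shared randomness `r`;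
`query i (r, w)` is the law of the score in `[0, 1]` returned on query `i`, given the shared
randomness `r` and the memory state `w`. Both algorithms may use further private randomness. -/
structure MembershipTester (u n : ℕ) where
  Rand : Type
  [measurableRand : MeasurableSpace Rand]
  Mem : Type
  [measurableMem : MeasurableSpace Mem]
  rand : Measure Rand
  [isProbabilityMeasure_rand : IsProbabilityMeasure rand]
  init : KeySet u n → Kernel Rand Mem
  [isMarkovKernel_init : ∀ K, IsMarkovKernel (init K)]
  query : Fin u → Kernel (Rand × Mem) unitInterval
  [isMarkovKernel_query : ∀ i, IsMarkovKernel (query i)]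

namespace MembershipTester

attribute [instance] measurableRand measurableMem isProbabilityMeasure_rand isMarkovKernel_init
  isMarkovKernel_query

variable {u n : ℕ}

/-- The law of (shared randomness, memory state) when the key set is `K`. -/
noncomputable def stateLaw (M : MembershipTester u n) (K : KeySet u n) : Measure (M.Rand × M.Mem) :=
  M.rand ⊗ₘ M.init K

/-- The law of the answer to query `i` when the key set is `K`. -/
noncomputable def queryLaw (M : MembershipTester u n) (K : KeySet u n) (i : Fin u) :
    Measure unitInterval :=
  (M.stateLaw K).bind (M.query i)

/-- Permutation invariance: relabelling the universe does not change the law of the answers. -/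
def PermInvariant (M : MembershipTester u n) : Prop :=
  ∀ (π : Equiv.Perm (Fin u)) (K : KeySet u n) (i : Fin u),
    M.queryLaw K i = M.queryLaw (K.perm π) (π i)

/-- `stateLaw` as a Markov kernel from key sets to states. -/
noncomputable def stateKernel (M : MembershipTester u n) :
    Kernel (KeySet u n) (M.Rand × M.Mem) :=
  ⟨M.stateLaw, measurable_of_countable _⟩

instance isMarkovKernel_stateKernel (M : MembershipTester u n) : IsMarkovKernel M.stateKernel :=
  ⟨fun K => inferInstanceAs (IsProbabilityMeasure (M.rand ⊗ₘ M.init K))⟩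

/-- The joint law of the key set, drawn uniformly among the sets of size `n`, and of the pair
(shared randomness, memory state). -/
noncomputable def jointLaw (M : MembershipTester u n) :
    Measure (KeySet u n × (M.Rand × M.Mem)) :=
  (uniformOn (Set.univ : Set (KeySet u n))) ⊗ₘ M.stateKernel

/-- The memory budget `B(M)`: the information in bits that the memory state `W` carries about the
uniformly random key set `K`, the shared randomness `R` being known to both algorithms. As `R` is
independent of `K`, one has `I(W; K | R) = I((R, W); K)`, which is the form used here. Without
shared randomness (`R` trivial) it is `I(W; K)`. -/
noncomputable def memoryBudget (M : MembershipTester u n) : ℝ≥0∞ :=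
  mutualInfoBits M.jointLaw

/-- The query output distribution `μ_K(M)` on keys: the law of the answer to a query drawn
uniformly among the keys of a uniformly random key set. For a permutation-invariant tester it is
the law of the answer to any key query, see `keyLaw_eq_queryLaw`. -/
noncomputable def keyLaw (M : MembershipTester u n) : Measure unitInterval :=
  (uniformOn {q : KeySet u n × Fin u | q.2 ∈ q.1.1}).bind fun q => M.queryLaw q.1 q.2

/-- The query output distribution `μ_N(M)` on non-keys, see `nonkeyLaw_eq_queryLaw`. -/
noncomputable def nonkeyLaw (M : MembershipTester u n) : Measure unitInterval :=
  (uniformOn {q : KeySet u n × Fin u | q.2 ∉ q.1.1}).bind fun q => M.queryLaw q.1 q.2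

/-- The tester achieves the error levels `(a, b)` under the error metrics `dK`, `dN`. -/
def AchievesError (M : MembershipTester u n) (dK dN : unitInterval → ℝ≥0∞) (a b : ℝ≥0∞) : Prop :=
  ∫⁻ x, dK x ∂M.keyLaw ≤ a ∧ ∫⁻ x, dN x ∂M.nonkeyLaw ≤ b

theorem bind_uniformOn_eq (M : MembershipTester u n) {S : Set (KeySet u n × Fin u)}
    (hS : S.Nonempty) (μ : Measure unitInterval)
    (h : ∀ q ∈ S, M.queryLaw q.1 q.2 = μ) :
    ((uniformOn S).bind fun q => M.queryLaw q.1 q.2) = μ := by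
  have hp : IsProbabilityMeasure (uniformOn S) :=
    isProbabilityMeasure_uniformOn (Set.toFinite S) hS
  have hae : ∀ᵐ q ∂(uniformOn S), q ∈ S := by
    rw [ae_iff]
    exact (prob_compl_eq_zero_iff (MeasurableSet.of_discrete (s := S))).2
      (uniformOn_self (Set.toFinite S) hS)
  ext A hA
  rw [Measure.bind_apply hA (measurable_of_countable _).aemeasurable]
  have : (fun q : KeySet u n × Fin u => M.queryLaw q.1 q.2 A) =ᵐ[uniformOn S] fun _ => μ A := by
    filter_upwards [hae] with q hq
    rw [h q hq]
  rw [lintegral_congr_ae this]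
  simp

theorem exists_perm (K K' : KeySet u n) (i i' : Fin u) (h : i ∈ K.1 ↔ i' ∈ K'.1) :
    ∃ π : Equiv.Perm (Fin u), K.perm π = K' ∧ π i = i' := by
  have hc : Fintype.card {x // x ∈ K.1} = Fintype.card {x // x ∈ K'.1} := by
    simp [K.2, K'.2]
  let e : {x // x ∈ K.1} ≃ {x // x ∈ K'.1} := Fintype.equivOfCardEq hc
  let σ : Equiv.Perm (Fin u) := e.extendSubtype
  have hσ : ∀ x, σ x ∈ K'.1 ↔ x ∈ K.1 := by
    intro x
    constructor
    · intro hx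
      by_contra hxK
      exact e.extendSubtype_not_mem x hxK hx
    · exact fun hx => e.extendSubtype_mem x hx
  let τ : Equiv.Perm (Fin u) := Equiv.swap (σ i) i'
  have hτ : ∀ x, τ x ∈ K'.1 ↔ x ∈ K'.1 := by
    intro x
    rcases eq_or_ne x (σ i) with rfl | h1
    · rw [show τ (σ i) = i' from Equiv.swap_apply_left _ _, hσ, h]
    · rcases eq_or_ne x i' with rfl | h2
      · rw [show τ x = σ i from Equiv.swap_apply_right _ _, hσ, h]
      · rw [show τ x = x from Equiv.swap_apply_of_ne_of_ne h1 h2]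
  refine ⟨σ.trans τ, ?_, by simp [τ]⟩
  apply Subtype.ext
  ext y
  simp only [KeySet.perm, Finset.mem_map, Equiv.coe_toEmbedding]
  constructor
  · rintro ⟨x, hx, rfl⟩
    exact (hτ _).2 ((hσ _).2 hx)
  · intro hy
    refine ⟨(σ.trans τ).symm y, ?_, Equiv.apply_symm_apply _ _⟩
    rw [← hσ, ← hτ]
    rwa [show τ (σ ((σ.trans τ).symm y)) = y from Equiv.apply_symm_apply (σ.trans τ) y]

theorem PermInvariant.queryLaw_eq {M : MembershipTester u n} (hM : M.PermInvariant)
    {K K' : KeySet u n} {i i' : Fin u} (h : i ∈ K.1 ↔ i' ∈ K'.1) :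
    M.queryLaw K i = M.queryLaw K' i' := by
  obtain ⟨π, rfl, rfl⟩ := exists_perm K K' i i' h
  exact hM π K i

theorem keyLaw_eq_queryLaw {M : MembershipTester u n} (hM : M.PermInvariant)
    {K : KeySet u n} {i : Fin u} (hi : i ∈ K.1) : M.keyLaw = M.queryLaw K i :=
  M.bind_uniformOn_eq ⟨(K, i), hi⟩ _ fun _ hq => hM.queryLaw_eq (iff_of_true hq hi)

theorem nonkeyLaw_eq_queryLaw {M : MembershipTester u n} (hM : M.PermInvariant)
    {K : KeySet u n} {i : Fin u} (hi : i ∉ K.1) : M.nonkeyLaw = M.queryLaw K i :=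
  M.bind_uniformOn_eq ⟨(K, i), hi⟩ _ fun _ hq => hM.queryLaw_eq (iff_of_false hq hi)

end MembershipTester

/-- The assumptions on the error metrics `dK`, `dN : [0, 1] → [0, ∞]` for keys and non-keys. -/
structure AdmissibleErrors (dK dN : unitInterval → ℝ≥0∞) : Prop where
  lsc_key : LowerSemicontinuous dK
  lsc_nonkey : LowerSemicontinuous dN
  key_one : dK 1 = 0
  nonkey_zero : dN 0 = 0
  exists_finite : ∃ c, dK c < ∞ ∧ dN c < ∞

/-- The feasible region: the Borel probability measures on `[0, 1]` with expected error at most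
`ε` under the error metric `d`. -/
def feasible (d : unitInterval → ℝ≥0∞) (ε : ℝ≥0∞) : Set (ProbabilityMeasure unitInterval) :=
  {μ | ∫⁻ x, d x ∂(μ : Measure unitInterval) ≤ ε}

/-! Converse. Divergence in nats is the supremum of `∫ f dμ + 1 - ∫ exp f dν` over bounded `f`, so
any test function on pairs (key set, state) bounds the information from below. Given `f` on scores,
let `v i` be the conditional mean of `f` of the answer to `i` given the state, let `m` be the
average of `exp (v i)` over the universe, and test with `∑ i ∈ K, v i - n (m - 1) + n log (1 -
n/u)`. Under the product of the marginals the state can be frozen while `K` stays uniform. Then `n!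
eₙ(a) ≤ (∑ a)ⁿ`, `n! (u choose n) ≥ (u - n)ⁿ` and `m exp (1 - m) ≤ 1` show that the exponential of
the test has mean at most 1 (`integral_exp_keyExponent_le_one`). Under the joint law, permutation
invariance and Jensen bound the mean of the test from below by `n` times the dual functional of the
two answer laws, up to terms that vanish with `n/u` (`integral_keyExponent_ge`). No independence
between queries is needed.

Limit. Probability measures on `[0, 1]` form a compact space, the feasible sets are closed and
divergence is weakly lower semicontinuous, being a supremum of continuous functionals. This makes
the minimum attained, and it turns a budget below `V` along a subsequence into a feasible limit pair
with divergence below `V`, a contradiction.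

Achievability. Store one independent score per element, with the optimal `μK` for keys and `μN` for
the rest. Comparing the joint law with a table of pure `μN` scores bounds the information by `n
KL(μK ‖ μN)` at every size (`memoryBudget_tableTester_le`); the converse shows that this is
asymptotically sharp. -/

section Variational

/-! ### Variational formula for the divergence -/

open InformationTheory Set

variable {α : Type*} [MeasurableSpace α]

/-- The convex-duality functional `∫ f dμ + 1 - ∫ exp f dν`, whose supremum over `f` is the
Kullback-Leibler divergence (in nats) of probability measures. -/
noncomputable def klDual (f : α → ℝ) (μ ν : Measure α) : ℝ :=
  ∫ x, f x ∂μ + 1 - ∫ x, Real.exp (f x) ∂ν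

/-- Young's inequality: `exp t - 1` is the convex conjugate of `klFun`, with equality at `t = log
r`. Integrated with `r = dμ/dν`, it is the easy half of the duality. -/
theorem mul_add_one_sub_exp_le_klFun {r : ℝ} (hr : 0 ≤ r) (t : ℝ) :
    r * t + 1 - Real.exp t ≤ klFun r := by
  rcases hr.eq_or_lt with rfl | hr
  · simp [klFun_zero, Real.exp_nonneg]
  · have h1 := Real.add_one_le_exp (t - Real.log r)
    rw [Real.exp_sub, Real.exp_log hr, le_div_iff₀ hr] at h1
    rw [klFun_apply]
    nlinarith

theorem integrable_of_abs_le {μ : Measure α} [IsFiniteMeasure μ] {f : α → ℝ} (hf : Measurable f)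
    {C : ℝ} (hC : ∀ x, |f x| ≤ C) : Integrable f μ :=
  Integrable.of_bound hf.aestronglyMeasurable C (Eventually.of_forall hC)

theorem integrable_exp_of_abs_le {μ : Measure α} [IsFiniteMeasure μ] {f : α → ℝ}
    (hf : Measurable f) {C : ℝ} (hC : ∀ x, |f x| ≤ C) :
    Integrable (fun x => Real.exp (f x)) μ := by
  refine integrable_of_abs_le hf.exp (C := Real.exp C) fun x => ?_
  rw [Real.abs_exp]
  exact Real.exp_le_exp.2 ((le_abs_self _).trans (hC x))

theorem klDual_le_klDiv {μ ν : Measure α} [IsProbabilityMeasure μ] [IsProbabilityMeasure ν]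
    {f : α → ℝ} (hf : Measurable f) {C : ℝ} (hC : ∀ x, |f x| ≤ C) :
    ENNReal.ofReal (klDual f μ ν) ≤ klDiv μ ν := by
  by_cases h : klDiv μ ν = ∞
  · simp [h]
  obtain ⟨hac, hint⟩ := klDiv_ne_top_iff.1 h
  rw [klDiv_eq_integral_klFun, if_pos ⟨hac, hint⟩]
  apply ENNReal.ofReal_le_ofReal
  have hexp : Integrable (fun x => Real.exp (f x)) ν := integrable_exp_of_abs_le hf hC
  have hr : Integrable (fun x => (μ.rnDeriv ν x).toReal * f x) ν :=
    (integrable_rnDeriv_smul_iff hac).2 (integrable_of_abs_le hf hC)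
  have hkl := (integrable_klFun_rnDeriv_iff hac).2 hint
  have heq : klDual f μ ν
      = ∫ x, ((μ.rnDeriv ν x).toReal * f x + 1 - Real.exp (f x)) ∂ν := by
    have hs : ∫ x, (μ.rnDeriv ν x).toReal * f x ∂ν = ∫ x, f x ∂μ :=
      integral_rnDeriv_smul hac
    have h1 : Integrable (fun x => (μ.rnDeriv ν x).toReal * f x + 1) ν :=
      hr.add (integrable_const 1)
    rw [integral_sub h1 hexp, integral_add hr (integrable_const 1), hs, klDual]
    simp
  rw [heq]
  exact integral_mono ((hr.add (integrable_const 1)).sub hexp) hkl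
    fun x => mul_add_one_sub_exp_le_klFun ENNReal.toReal_nonneg (f x)

theorem integral_le_klDiv_of_integral_exp_le_one {μ ν : Measure α} [IsProbabilityMeasure μ]
    [IsProbabilityMeasure ν] {f : α → ℝ} (hf : Measurable f) {C : ℝ} (hC : ∀ x, |f x| ≤ C)
    (h1 : ∫ x, Real.exp (f x) ∂ν ≤ 1) : ENNReal.ofReal (∫ x, f x ∂μ) ≤ klDiv μ ν :=
  (ENNReal.ofReal_le_ofReal (by rw [klDual]; linarith)).trans (klDual_le_klDiv hf hC)

/-- Clamping a real number to `[-m, m]`. -/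
noncomputable def clamp (m x : ℝ) : ℝ := max (-m) (min m x)

theorem continuous_clamp (m : ℝ) : Continuous (clamp m) := by unfold clamp; fun_prop

theorem abs_clamp_le {m : ℝ} (hm : 0 ≤ m) (x : ℝ) : |clamp m x| ≤ m := by
  rw [abs_le, clamp]
  exact ⟨le_max_left _ _, max_le (by linarith) (min_le_left _ _)⟩

theorem abs_sub_clamp_le {m x : ℝ} (hx : |x| ≤ m) (y : ℝ) : |x - clamp m y| ≤ |x - y| := by
  have hx' : clamp m x = x := by
    rw [clamp, min_eq_right (abs_le.1 hx).2, max_eq_right (abs_le.1 hx).1]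
  have h1 := abs_max_sub_max_le_max (-m) (min m x) (-m) (min m y)
  have h2 := abs_min_sub_min_le_max m x m y
  simp only [sub_self, abs_zero, abs_nonneg, max_eq_right] at h1 h2
  calc |x - clamp m y| = |clamp m x - clamp m y| := by rw [hx']
    _ ≤ |x - y| := h1.trans h2

theorem exp_sub_exp_le {m a b : ℝ} (ha : a ≤ m) :
    Real.exp a - Real.exp b ≤ Real.exp m * |a - b| := by
  have h1 := Real.add_one_le_exp (b - a)
  have h2 : Real.exp b = Real.exp a * Real.exp (b - a) := by rw [← Real.exp_add]; ring_nf
  have h3 : Real.exp a - Real.exp b ≤ Real.exp a * |a - b| := by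
    rw [h2]
    nlinarith [Real.exp_pos a, le_abs_self (a - b)]
  exact h3.trans (mul_le_mul_of_nonneg_right (Real.exp_le_exp.2 ha) (abs_nonneg _))

section Continuous

variable [TopologicalSpace α] [BorelSpace α] [TopologicalSpace.PseudoMetrizableSpace α]

/-- Approximation in `L¹(μ + ν)` controls both integrals at once. Clamping the approximant to `[-m,
m]` brings it no farther from `f` and makes the exponential error at most `exp m` times the `L¹`
error. -/
theorem exists_continuous_klDual_ge {μ ν : Measure α} [IsProbabilityMeasure μ]
    [IsProbabilityMeasure ν] {f : α → ℝ} (hf : Measurable f) {m : ℝ} (hC : ∀ x, |f x| ≤ m)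
    {ε : ℝ} (hε : 0 < ε) :
    ∃ g : BoundedContinuousFunction α ℝ, klDual f μ ν ≤ klDual g μ ν + ε := by
  have hm : 0 ≤ m := by
    obtain ⟨x⟩ : Nonempty α := nonempty_of_isProbabilityMeasure μ
    exact (abs_nonneg _).trans (hC x)
  set δ := ε / (1 + Real.exp m) with hδ
  have hpos : 0 < 1 + Real.exp m := by positivity
  have hδ0 : 0 < δ := by positivity
  obtain ⟨g, hg, -⟩ := (integrable_of_abs_le (μ := μ + ν) hf hC).exists_boundedContinuous_integral_sub_le hδ0
  let g' : BoundedContinuousFunction α ℝ :=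
    BoundedContinuousFunction.ofNormedAddCommGroup (fun x => clamp m (g x))
      ((continuous_clamp m).comp g.continuous) m fun x => abs_clamp_le hm _
  have hg'm : Measurable g' := g'.continuous.measurable
  have hg'C : ∀ x, |g' x| ≤ m := fun x => abs_clamp_le hm _
  refine ⟨g', ?_⟩
  have hi : ∀ ρ : Measure α, IsFiniteMeasure ρ → Integrable (fun x => |f x - g x|) ρ := fun ρ _ =>
    ((integrable_of_abs_le hf hC).sub (g.integrable ρ)).abs
  have hadd : ∫ x, |f x - g x| ∂μ + ∫ x, |f x - g x| ∂ν ≤ δ := by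
    rw [← integral_add_measure (hi μ inferInstance) (hi ν inferInstance)]
    exact hg
  have h1 : ∫ x, f x ∂μ - ∫ x, g' x ∂μ ≤ ∫ x, |f x - g x| ∂μ := by
    rw [← integral_sub (integrable_of_abs_le hf hC) (integrable_of_abs_le hg'm hg'C)]
    refine integral_mono ((integrable_of_abs_le hf hC).sub (integrable_of_abs_le hg'm hg'C))
      (hi μ inferInstance) fun x => ?_
    exact (le_abs_self _).trans (abs_sub_clamp_le (hC x) _)
  have h2 : ∫ x, Real.exp (g' x) ∂ν - ∫ x, Real.exp (f x) ∂ν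
      ≤ Real.exp m * ∫ x, |f x - g x| ∂ν := by
    rw [← integral_sub (integrable_exp_of_abs_le hg'm hg'C) (integrable_exp_of_abs_le hf hC),
      ← integral_const_mul]
    refine integral_mono ((integrable_exp_of_abs_le hg'm hg'C).sub
      (integrable_exp_of_abs_le hf hC)) ((hi ν inferInstance).const_mul _) fun x => ?_
    refine (exp_sub_exp_le ((le_abs_self _).trans (hg'C x))).trans ?_
    refine mul_le_mul_of_nonneg_left ?_ (Real.exp_pos m).le
    rw [abs_sub_comm]
    exact abs_sub_clamp_le (hC x) _
  have h3 : 0 ≤ ∫ x, |f x - g x| ∂μ := integral_nonneg fun _ => abs_nonneg _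
  have h4 : 0 ≤ ∫ x, |f x - g x| ∂ν := integral_nonneg fun _ => abs_nonneg _
  have h5 : (1 + Real.exp m) * δ = ε := by rw [hδ]; field_simp
  rw [klDual, klDual]
  nlinarith [Real.exp_pos m]

theorem klDual_le_of_forall_continuous {μ ν : Measure α} [IsProbabilityMeasure μ]
    [IsProbabilityMeasure ν] {c : ℝ}
    (h : ∀ g : BoundedContinuousFunction α ℝ, klDual g μ ν ≤ c)
    {f : α → ℝ} (hf : Measurable f) {m : ℝ} (hC : ∀ x, |f x| ≤ m) : klDual f μ ν ≤ c := by
  refine le_of_forall_pos_le_add fun ε hε => ?_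
  obtain ⟨g, hg⟩ := exists_continuous_klDual_ge (μ := μ) (ν := ν) hf hC hε
  exact hg.trans (by linarith [h g])

end Continuous

/-- On a `ν`-null set `A`, the test function `m · 1_A` has dual value `m μ(A)`, which stays bounded
in `m` only if `μ(A) = 0`. -/
theorem absolutelyContinuous_of_klDual_le {μ ν : Measure α} [IsProbabilityMeasure μ]
    [IsProbabilityMeasure ν] {c : ℝ}
    (h : ∀ (f : α → ℝ) (m : ℝ), Measurable f → (∀ x, |f x| ≤ m) → klDual f μ ν ≤ c) :
    μ ≪ ν := by
  refine Measure.AbsolutelyContinuous.mk fun A hA hνA => ?_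
  have key : ∀ m : ℕ, m * μ.real A ≤ c := by
    intro m
    have h0 := h (A.indicator fun _ => (m : ℝ)) m (measurable_const.indicator hA) fun x => by
      by_cases hx : x ∈ A <;> simp [hx]
    have h1 : ∫ x, A.indicator (fun _ => (m : ℝ)) x ∂μ = m * μ.real A := by
      rw [integral_indicator_const _ hA, smul_eq_mul, mul_comm]
    have h2 : ∫ x, Real.exp (A.indicator (fun _ => (m : ℝ)) x) ∂ν = 1 := by
      have : (fun x => Real.exp (A.indicator (fun _ => (m : ℝ)) x)) =ᵐ[ν] fun _ => 1 := by
        filter_upwards [measure_eq_zero_iff_ae_notMem.1 hνA] with x hx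
        simp [hx]
      rw [integral_congr_ae this]
      simp
    rw [klDual, h1, h2] at h0
    linarith
  have h0 : μ.real A = 0 := by
    by_contra hne
    have hpos : 0 < μ.real A := lt_of_le_of_ne measureReal_nonneg (Ne.symm hne)
    obtain ⟨m, hm⟩ := exists_nat_gt (c / μ.real A)
    rw [div_lt_iff₀ hpos] at hm
    linarith [key m]
  exact (measureReal_eq_zero_iff).1 h0

/-- With `q` the clipped `r`, the factors `r - q` and `log q` never have opposite signs, so `r log q
≥ q log q ≥ q - 1`. This positivity is what Fatou's lemma requires. -/
theorem mul_log_clip_nonneg {r a b : ℝ} (ha : 0 < a) (ha1 : a ≤ 1) (hb : 1 ≤ b) :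
    0 ≤ r * Real.log (max a (min b r)) + 1 - max a (min b r) := by
  set q := max a (min b r) with hq
  have hq0 : 0 < q := ha.trans_le (le_max_left _ _)
  have h1 : q - 1 ≤ q * Real.log q := by
    have := Real.one_sub_inv_le_log_of_pos hq0
    calc q - 1 = q * (1 - q⁻¹) := by field_simp
      _ ≤ _ := mul_le_mul_of_nonneg_left this hq0.le
  have h2 : q * Real.log q ≤ r * Real.log q := by
    rcases le_total 1 r with h | h
    · have h1q : 1 ≤ q := (le_min hb h).trans (le_max_right _ _)
      exact mul_le_mul_of_nonneg_right (max_le (ha1.trans h) (min_le_right _ _))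
        (Real.log_nonneg h1q)
    · have hrq : r ≤ q := (le_min (h.trans hb) le_rfl).trans (le_max_right _ _)
      exact mul_le_mul_of_nonpos_right hrq
        (Real.log_nonpos hq0.le (max_le ha1 ((min_le_right _ _).trans h)))
  linarith

theorem tendsto_mul_log_clip {r : ℝ} (hr : 0 ≤ r) :
    Tendsto (fun m : ℕ => r * Real.log (max (Real.exp (-(m : ℝ))) (min (Real.exp m) r)) + 1
      - max (Real.exp (-(m : ℝ))) (min (Real.exp m) r)) atTop (𝓝 (klFun r)) := by
  have hbot : Tendsto (fun m : ℕ => Real.exp (-(m : ℝ))) atTop (𝓝 0) :=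
    Real.tendsto_exp_neg_atTop_nhds_zero.comp tendsto_natCast_atTop_atTop
  have htop : Tendsto (fun m : ℕ => Real.exp (m : ℝ)) atTop atTop :=
    Real.tendsto_exp_atTop.comp tendsto_natCast_atTop_atTop
  rcases hr.eq_or_lt with rfl | hr
  · have : ∀ m : ℕ, max (Real.exp (-(m : ℝ))) (min (Real.exp m) 0) = Real.exp (-(m : ℝ)) := by
      intro m
      exact max_eq_left ((min_le_right _ _).trans (Real.exp_pos _).le)
    simp only [this, zero_mul, zero_add, klFun_zero]
    simpa using hbot.const_sub 1
  · refine tendsto_const_nhds.congr' ?_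
    filter_upwards [hbot.eventually_le_const hr, htop.eventually_ge_atTop r] with m h1 h2
    rw [min_eq_right h2, max_eq_right h1, klFun_apply]

/-- The optimal test function `log (dμ/dν)` may be unbounded, so it is clipped to `[-m, m]`; Fatou
recovers the divergence as `m → ∞`. -/
theorem klDiv_le_of_klDual_le {μ ν : Measure α} [IsProbabilityMeasure μ]
    [IsProbabilityMeasure ν] {c : ℝ}
    (h : ∀ (f : α → ℝ) (m : ℝ), Measurable f → (∀ x, |f x| ≤ m) → klDual f μ ν ≤ c) :
    klDiv μ ν ≤ ENNReal.ofReal c := by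
  have hac := absolutelyContinuous_of_klDual_le h
  rw [klDiv_eq_lintegral_klFun_of_ac hac]
  set r : α → ℝ := fun x => (μ.rnDeriv ν x).toReal with hr
  have hrm : Measurable r := (Measure.measurable_rnDeriv μ ν).ennreal_toReal
  let q : ℕ → α → ℝ := fun m x => max (Real.exp (-(m : ℝ))) (min (Real.exp m) (r x))
  have hqm : ∀ m, Measurable (q m) := fun m => measurable_const.max (measurable_const.min hrm)
  have hq0 : ∀ m x, 0 < q m x := fun m x => (Real.exp_pos _).trans_le (le_max_left _ _)
  have hqb : ∀ m x, |Real.log (q m x)| ≤ m := by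
    intro m x
    have h1 : Real.exp (-(m : ℝ)) ≤ q m x := le_max_left _ _
    have h2 : q m x ≤ Real.exp m :=
      max_le (Real.exp_le_exp.2 (by linarith [(Nat.cast_nonneg m : (0 : ℝ) ≤ m)]))
        (min_le_left _ _)
    exact abs_le.2 ⟨(Real.le_log_iff_exp_le (hq0 m x)).2 h1, (Real.log_le_iff_le_exp (hq0 m x)).2 h2⟩
  have hlim : ∀ x, Tendsto (fun m => ENNReal.ofReal (r x * Real.log (q m x) + 1 - q m x)) atTop
      (𝓝 (ENNReal.ofReal (klFun (r x)))) := fun x =>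
    (ENNReal.continuous_ofReal.tendsto _).comp (tendsto_mul_log_clip ENNReal.toReal_nonneg)
  calc ∫⁻ x, ENNReal.ofReal (klFun (r x)) ∂ν
      = ∫⁻ x, liminf (fun m => ENNReal.ofReal (r x * Real.log (q m x) + 1 - q m x)) atTop ∂ν :=
        lintegral_congr fun x => ((hlim x).liminf_eq).symm
    _ ≤ liminf (fun m => ∫⁻ x, ENNReal.ofReal (r x * Real.log (q m x) + 1 - q m x) ∂ν) atTop :=
        lintegral_liminf_le fun m =>
          (((hrm.mul (hqm m).log).add measurable_const).sub (hqm m)).ennreal_ofReal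
    _ ≤ liminf (fun _ : ℕ => ENNReal.ofReal c) atTop := by
        refine liminf_le_liminf (Eventually.of_forall fun m => ?_)
        have hlog : Measurable fun x => Real.log (q m x) := (hqm m).log
        have hi1 : Integrable (fun x => r x * Real.log (q m x)) ν :=
          (integrable_rnDeriv_smul_iff hac).2 (integrable_of_abs_le hlog (hqb m))
        have hexp : (fun x => Real.exp (Real.log (q m x))) = q m :=
          funext fun x => Real.exp_log (hq0 m x)
        have hi2 : Integrable (q m) ν := by
          rw [← hexp]
          exact integrable_exp_of_abs_le hlog (hqb m)
        have hi3 : Integrable (fun x => r x * Real.log (q m x) + 1) ν :=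
          hi1.add (integrable_const 1)
        have hi4 : Integrable (fun x => r x * Real.log (q m x) + 1 - q m x) ν := hi3.sub hi2
        rw [← ofReal_integral_eq_lintegral_ofReal hi4 (Eventually.of_forall fun x => ?_)]
        · apply ENNReal.ofReal_le_ofReal
          have hs : ∫ x, r x * Real.log (q m x) ∂ν = ∫ x, Real.log (q m x) ∂μ :=
            integral_rnDeriv_smul hac
          refine le_trans (le_of_eq ?_) (h _ m hlog (hqb m))
          rw [integral_sub hi3 hi2, integral_add hi1 (integrable_const 1), hs, klDual, hexp]
          simp
        · exact mul_log_clip_nonneg (Real.exp_pos _) (Real.exp_le_one_iff.2 (by simp))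
            (Real.one_le_exp (by simp))
    _ = ENNReal.ofReal c := by simp

theorem klDiv_le_of_forall_continuous [TopologicalSpace α] [BorelSpace α]
    [TopologicalSpace.PseudoMetrizableSpace α] {μ ν : Measure α} [IsProbabilityMeasure μ]
    [IsProbabilityMeasure ν] {c : ℝ}
    (h : ∀ g : BoundedContinuousFunction α ℝ, klDual g μ ν ≤ c) :
    klDiv μ ν ≤ ENNReal.ofReal c :=
  klDiv_le_of_klDual_le fun _ _ hf hC => klDual_le_of_forall_continuous h hf hC

end Variational

/-! ### Weak lower semicontinuity of divergence and of expected errors -/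

section Topological

open InformationTheory Set

variable {α : Type*} [MeasurableSpace α] [TopologicalSpace α] [BorelSpace α]

theorem measurable_boundedContinuousFunction (g : BoundedContinuousFunction α ℝ) :
    Measurable g := g.continuous.measurable

theorem abs_boundedContinuousFunction_le {β : Type*} [TopologicalSpace β]
    (g : BoundedContinuousFunction β ℝ) (x : β) :
    |g x| ≤ ‖g‖ := g.norm_coe_le_norm x

theorem continuous_exp_integral (g : BoundedContinuousFunction α ℝ) :
    Continuous fun μ : ProbabilityMeasure α => ∫ x, Real.exp (g x) ∂(μ : Measure α) := by
  let e : BoundedContinuousFunction α ℝ :=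
    BoundedContinuousFunction.ofNormedAddCommGroup (fun x => Real.exp (g x))
      (Real.continuous_exp.comp g.continuous) (Real.exp ‖g‖) fun x => by
        rw [Real.norm_eq_abs, Real.abs_exp]
        exact Real.exp_le_exp.2 ((le_abs_self _).trans (abs_boundedContinuousFunction_le g x))
  exact ProbabilityMeasure.continuous_integral_boundedContinuousFunction e

theorem continuous_klDual (g : BoundedContinuousFunction α ℝ) :
    Continuous fun p : ProbabilityMeasure α × ProbabilityMeasure α =>
      klDual g (p.1 : Measure α) (p.2 : Measure α) := by
  unfold klDual
  exact (((ProbabilityMeasure.continuous_integral_boundedContinuousFunction g).comp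
    continuous_fst).add continuous_const).sub ((continuous_exp_integral g).comp continuous_snd)

theorem klDiv_eq_iSup_klDual [TopologicalSpace.PseudoMetrizableSpace α]
    (μ ν : Measure α) [IsProbabilityMeasure μ] [IsProbabilityMeasure ν] :
    klDiv μ ν = ⨆ g : BoundedContinuousFunction α ℝ, ENNReal.ofReal (klDual g μ ν) := by
  refine le_antisymm ?_ (iSup_le fun g => klDual_le_klDiv (measurable_boundedContinuousFunction g)
    (abs_boundedContinuousFunction_le g))
  by_cases hS : (⨆ g : BoundedContinuousFunction α ℝ, ENNReal.ofReal (klDual g μ ν)) = ∞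
  · simp [hS]
  · rw [← ENNReal.ofReal_toReal hS]
    refine klDiv_le_of_forall_continuous fun g => ?_
    rw [← ENNReal.ofReal_le_iff_le_toReal hS]
    exact le_iSup (fun g : BoundedContinuousFunction α ℝ => ENNReal.ofReal (klDual g μ ν)) g

theorem lowerSemicontinuous_klDiv [TopologicalSpace.PseudoMetrizableSpace α] :
    LowerSemicontinuous fun p : ProbabilityMeasure α × ProbabilityMeasure α =>
      klDiv (p.1 : Measure α) (p.2 : Measure α) := by
  simp_rw [klDiv_eq_iSup_klDual]
  exact lowerSemicontinuous_iSup fun g =>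
    (ENNReal.continuous_ofReal.comp (continuous_klDual g)).lowerSemicontinuous

/-- Layer-cake formula: the sets `{f > t}` are open, so the portmanteau inequality holds for each
`t`, and Fatou integrates it over `t`. -/
theorem lintegral_le_liminf_of_lowerSemicontinuous_real
    [HasOuterApproxClosed α] {f : α → ℝ} (hf : LowerSemicontinuous f) (h0 : 0 ≤ f)
    {μs : ℕ → ProbabilityMeasure α} {μ : ProbabilityMeasure α} (h : Tendsto μs atTop (𝓝 μ)) :
    ∫⁻ x, ENNReal.ofReal (f x) ∂(μ : Measure α)
      ≤ liminf (fun i => ∫⁻ x, ENNReal.ofReal (f x) ∂(μs i : Measure α)) atTop := by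
  simp_rw [lintegral_eq_lintegral_meas_lt _ (Eventually.of_forall h0) hf.measurable.aemeasurable]
  refine (lintegral_mono fun t => ?_).trans (lintegral_liminf_le fun n =>
    Antitone.measurable fun s t hst => measure_mono fun ω hω => lt_of_le_of_lt hst hω)
  exact ProbabilityMeasure.le_liminf_measure_open_of_tendsto h (hf.isOpen_preimage t)

theorem lowerSemicontinuous_toReal_min {β : Type*} [TopologicalSpace β] {d : β → ℝ≥0∞}
    (hd : LowerSemicontinuous d) (N : ℕ) :
    LowerSemicontinuous fun x => (min (d x) N).toReal := by
  have hmono : Monotone fun y : ℝ≥0∞ => (min y (N : ℝ≥0∞)).toReal := fun a b hab =>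
    ENNReal.toReal_mono (ne_top_of_le_ne_top (ENNReal.natCast_ne_top N) (min_le_right _ _))
      (min_le_min_right _ hab)
  have hcont : Continuous fun y : ℝ≥0∞ => (min y (N : ℝ≥0∞)).toReal :=
    ENNReal.continuousOn_toReal.comp_continuous (continuous_id.min continuous_const) fun y =>
      ne_top_of_le_ne_top (ENNReal.natCast_ne_top N) (min_le_right _ _)
  exact hcont.comp_lowerSemicontinuous hd hmono

theorem lintegral_eq_iSup_min {β : Type*} [MeasurableSpace β] {d : β → ℝ≥0∞}
    (hd : Measurable d) (μ : Measure β) :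
    ∫⁻ x, d x ∂μ = ⨆ N : ℕ, ∫⁻ x, ENNReal.ofReal (min (d x) N).toReal ∂μ := by
  have hne : ∀ (N : ℕ) x, min (d x) (N : ℝ≥0∞) ≠ ∞ := fun N x =>
    ne_top_of_le_ne_top (ENNReal.natCast_ne_top N) (min_le_right _ _)
  simp_rw [ENNReal.ofReal_toReal (hne _ _)]
  rw [← lintegral_iSup (fun N => hd.min measurable_const)]
  · refine lintegral_congr fun x => ?_
    exact (inf_iSup_eq (d x) fun N : ℕ => (N : ℝ≥0∞)).symm.trans (by simp [ENNReal.iSup_natCast]) |>.symm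
  · intro a b hab x
    exact min_le_min_left _ (Nat.cast_le.2 hab)

/-- Truncating `d` at each `N` makes it real-valued and keeps it lower semicontinuous; the set is
the intersection of the truncated ones. -/
theorem isClosed_lintegral_le [TopologicalSpace.PseudoMetrizableSpace α]
    [TopologicalSpace.SeparableSpace α] {d : α → ℝ≥0∞} (hd : LowerSemicontinuous d) (c : ℝ≥0∞) :
    IsClosed {μ : ProbabilityMeasure α | ∫⁻ x, d x ∂(μ : Measure α) ≤ c} := by
  simp_rw [lintegral_eq_iSup_min hd.measurable, iSup_le_iff, ofPred_forall]
  refine isClosed_iInter fun N => IsSeqClosed.isClosed fun μs μ hs hμ => ?_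
  refine (lintegral_le_liminf_of_lowerSemicontinuous_real (lowerSemicontinuous_toReal_min hd N)
    (fun _ => ENNReal.toReal_nonneg) hμ).trans ?_
  exact (liminf_le_liminf (Eventually.of_forall hs)).trans (by simp)

end Topological

/-! ### Existence of the minimum -/

theorem isClosed_feasible {d : unitInterval → ℝ≥0∞} (hd : LowerSemicontinuous d) (ε : ℝ≥0∞) :
    IsClosed (feasible d ε) := isClosed_lintegral_le hd ε

theorem diracProba_mem_feasible {d : unitInterval → ℝ≥0∞} (hd : LowerSemicontinuous d)
    {x : unitInterval} (hx : d x = 0) (ε : ℝ≥0∞) : diracProba x ∈ feasible d ε := by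
  change ∫⁻ y, d y ∂(Measure.dirac x) ≤ ε
  rw [lintegral_dirac' x hd.measurable, hx]
  exact zero_le

theorem exists_klBits_minimizer {dK dN : unitInterval → ℝ≥0∞} (hd : AdmissibleErrors dK dN)
    (εK εN : ℝ≥0∞) :
    ∃ μK ∈ feasible dK εK, ∃ μN ∈ feasible dN εN, ∀ νK ∈ feasible dK εK, ∀ νN ∈ feasible dN εN,
      klBits (μK : Measure unitInterval) (μN : Measure unitInterval)
        ≤ klBits (νK : Measure unitInterval) (νN : Measure unitInterval) := by
  have hc : IsCompact (feasible dK εK ×ˢ feasible dN εN) :=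
    ((isClosed_feasible hd.lsc_key εK).prod (isClosed_feasible hd.lsc_nonkey εN)).isCompact
  have hne : (feasible dK εK ×ˢ feasible dN εN).Nonempty :=
    ⟨(diracProba 1, diracProba 0), diracProba_mem_feasible hd.lsc_key hd.key_one εK,
      diracProba_mem_feasible hd.lsc_nonkey hd.nonkey_zero εN⟩
  obtain ⟨⟨μK, μN⟩, ⟨hK, hN⟩, hmin⟩ := LowerSemicontinuousOn.exists_isMinOn hne hc
    ((lowerSemicontinuous_klDiv (α := unitInterval)).lowerSemicontinuousOn _)
  refine ⟨μK, hK, μN, hN, fun νK hνK νN hνN => ENNReal.div_le_div_right ?_ _⟩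
  exact isMinOn_iff.1 hmin (νK, νN) ⟨hνK, hνN⟩

/-! ### Exponential moments of a uniformly random key set -/

/-- The elementary symmetric sums of nonnegative reals satisfy `n! eₙ(a) ≤ (∑ a)ⁿ`. -/
theorem factorial_mul_sum_powersetCard_prod_le {ι : Type*} [DecidableEq ι] {a : ι → ℝ}
    (ha : ∀ i, 0 ≤ a i) (s : Finset ι) (n : ℕ) :
    (n.factorial : ℝ) * ∑ t ∈ s.powersetCard n, ∏ i ∈ t, a i ≤ (∑ i ∈ s, a i) ^ n := by
  induction s using Finset.induction_on generalizing n with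
  | empty =>
    rcases n with _ | n
    · simp
    · rw [Finset.powersetCard_eq_empty.2 (by simp)]
      simp
  | insert x s hx ih =>
    rcases n with _ | n
    · simp
    rw [Finset.powersetCard_succ_insert hx, Finset.sum_union, Finset.sum_image,
      Finset.sum_insert hx]
    · have h1 : ∑ t ∈ s.powersetCard n, ∏ i ∈ insert x t, a i
          = a x * ∑ t ∈ s.powersetCard n, ∏ i ∈ t, a i := by
        rw [Finset.mul_sum]
        refine Finset.sum_congr rfl fun t ht => ?_
        exact Finset.prod_insert fun hxt => hx ((Finset.mem_powersetCard.1 ht).1 hxt)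
      have hS : 0 ≤ ∑ i ∈ s, a i := Finset.sum_nonneg fun i _ => ha i
      -- Subsets avoiding `x` and subsets containing `x` are matched with the terms `Sⁿ⁺¹` and `(n +
      -- 1) Sⁿ a x` of the binomial expansion.
      have h2 := pow_add_mul_le_add_pow (n := n + 1) hS (b := a x) (by linarith [ha x])
      have h3 := mul_le_mul_of_nonneg_left (ih n) (mul_nonneg (Nat.cast_nonneg (n + 1)) (ha x))
      have h4 := ih (n + 1)
      rw [h1, mul_add]
      refine (add_le_add h4 (le_of_eq_of_le ?_ h3)).trans (le_of_le_of_eq ?_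
        (congrArg (· ^ (n + 1)) (add_comm _ (a x))))
      · rw [Nat.factorial_succ]
        push_cast
        ring
      · refine le_of_eq_of_le ?_ h2
        simp only [Nat.add_sub_cancel]
        ring
    · intro t ht t' ht' h
      have hxt : x ∉ t := fun h' => hx ((Finset.mem_powersetCard.1 ht).1 h')
      have hxt' : x ∉ t' := fun h' => hx ((Finset.mem_powersetCard.1 ht').1 h')
      rw [← Finset.erase_insert hxt, h, Finset.erase_insert hxt']
    · rw [Finset.disjoint_left]
      intro t ht ht'
      obtain ⟨t', -, rfl⟩ := Finset.mem_image.1 ht'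
      exact hx ((Finset.mem_powersetCard.1 ht).1 (Finset.mem_insert_self x t'))

section KeySet

variable {u n : ℕ}

theorem sum_keySet (g : Finset (Fin u) → ℝ) :
    ∑ K : KeySet u n, g K.1 = ∑ t ∈ (Finset.univ : Finset (Fin u)).powersetCard n, g t := by
  symm
  refine Finset.sum_subtype _ (fun t => ?_) g
  simp [Finset.mem_powersetCard]

theorem card_keySet : Fintype.card (KeySet u n) = u.choose n := by
  have h := Finset.card_powersetCard n (Finset.univ : Finset (Fin u))
  rw [Finset.card_univ, Fintype.card_fin] at h
  rw [← h]
  exact Fintype.card_of_subtype _ fun t => by simp [Finset.mem_powersetCard]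

theorem nonempty_keySet (h : n ≤ u) : Nonempty (KeySet u n) := by
  rw [← Fintype.card_pos_iff, card_keySet]
  exact Nat.choose_pos h

theorem isProbabilityMeasure_uniformOn_keySet (h : n ≤ u) :
    IsProbabilityMeasure (uniformOn (Set.univ : Set (KeySet u n))) :=
  have := nonempty_keySet h
  isProbabilityMeasure_uniformOn Set.finite_univ Set.univ_nonempty

theorem integral_uniformOn_keySet (g : KeySet u n → ℝ) :
    ∫ K, g K ∂(uniformOn (Set.univ : Set (KeySet u n)))
      = (u.choose n : ℝ)⁻¹ * ∑ K, g K := by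
  have hs : ∀ K : KeySet u n, (uniformOn (Set.univ : Set (KeySet u n))).real {K}
      = (u.choose n : ℝ)⁻¹ := by
    intro K
    rw [measureReal_def, uniformOn_univ, Measure.count_singleton, card_keySet]
    simp
  have : IsFiniteMeasure (uniformOn (Set.univ : Set (KeySet u n))) := by
    unfold uniformOn; infer_instance
  rw [integral_fintype (Integrable.of_finite), Finset.mul_sum]
  exact Finset.sum_congr rfl fun K _ => by rw [hs, smul_eq_mul]

/-- Comparison with `n` independent draws from `[u]`: sampling without replacement costs at most a
factor `(u / (u - n))ⁿ`, from `n! (u choose n) ≥ (u - n)ⁿ`. -/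
theorem integral_exp_sum_keySet_le (hn : n < u) (v : Fin u → ℝ) :
    ∫ K : KeySet u n, Real.exp (∑ i ∈ K.1, v i) ∂(uniformOn Set.univ)
      ≤ ((∑ i, Real.exp (v i)) / (u - n)) ^ n := by
  rw [integral_uniformOn_keySet, sum_keySet (g := fun t => Real.exp (∑ i ∈ t, v i))]
  simp_rw [Real.exp_sum]
  have h1 := factorial_mul_sum_powersetCard_prod_le (a := fun i => Real.exp (v i))
    (fun i => (Real.exp_pos _).le) Finset.univ n
  have hpos : (0 : ℝ) < u - n := by rw [sub_pos]; exact_mod_cast hn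
  have h2 : ((u : ℝ) - n) ^ n ≤ n.factorial * u.choose n := by
    have h3 : (u - n) ^ n ≤ n.factorial * u.choose n := by
      rw [← Nat.descFactorial_eq_factorial_mul_choose]
      exact (Nat.pow_le_pow_left (by omega) n).trans (Nat.pow_sub_le_descFactorial u n)
    have h4 : (((u - n : ℕ) ^ n : ℕ) : ℝ) ≤ ((n.factorial * u.choose n : ℕ) : ℝ) := by
      exact_mod_cast h3
    push_cast [Nat.cast_sub hn.le] at h4
    exact h4
  have hc : (0 : ℝ) < u.choose n := by exact_mod_cast Nat.choose_pos hn.le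
  rw [div_pow, le_div_iff₀ (pow_pos hpos n), inv_mul_eq_div, div_mul_eq_mul_div,
    div_le_iff₀ hc]
  have hE : 0 ≤ ∑ t ∈ (Finset.univ : Finset (Fin u)).powersetCard n, ∏ i ∈ t, Real.exp (v i) :=
    Finset.sum_nonneg fun t _ => Finset.prod_nonneg fun i _ => (Real.exp_pos _).le
  calc _ ≤ (∑ t ∈ (Finset.univ : Finset (Fin u)).powersetCard n, ∏ i ∈ t, Real.exp (v i))
        * (n.factorial * u.choose n) := mul_le_mul_of_nonneg_left h2 hE
    _ = (n.factorial * ∑ t ∈ (Finset.univ : Finset (Fin u)).powersetCard n,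
        ∏ i ∈ t, Real.exp (v i)) * u.choose n := by ring
    _ ≤ _ := mul_le_mul_of_nonneg_right h1 hc.le

/-- The exponent that tests the dependence between a random key set and a vector of scores. -/
noncomputable def keyExponent (K : KeySet u n) (v : Fin u → ℝ) : ℝ :=
  ∑ i ∈ K.1, v i - n * ((∑ i, Real.exp (v i)) / u - 1) + n * Real.log (1 - n / u)

/-- The term `n log (1 - n/u)` cancels the cost of sampling without replacement, leaving `(m exp (1
- m))ⁿ ≤ 1`. Subtracting `m - 1` instead of the smaller `log m` keeps the exponent affine in the
`exp (v i)`, so its mean is computable from single queries. -/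
theorem integral_exp_keyExponent_le_one (hn : n < u) (v : Fin u → ℝ) :
    ∫ K : KeySet u n, Real.exp (keyExponent K v) ∂(uniformOn Set.univ) ≤ 1 := by
  have hu : (0 : ℝ) < u := by exact_mod_cast (Nat.zero_le n).trans_lt hn
  have hpos : (0 : ℝ) < u - n := by rw [sub_pos]; exact_mod_cast hn
  have hp : (1 : ℝ) - n / u = (u - n) / u := by field_simp
  set m := (∑ i, Real.exp (v i)) / u with hm
  have hm0 : 0 ≤ m := div_nonneg (Finset.sum_nonneg fun i _ => (Real.exp_pos _).le) hu.le
  have hsplit : ∀ K : KeySet u n, Real.exp (keyExponent K v)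
      = Real.exp (∑ i ∈ K.1, v i) * (Real.exp (1 - m) * ((u - n) / u)) ^ n := by
    intro K
    rw [keyExponent, ← hm, hp, show ∑ i ∈ K.1, v i - n * (m - 1) + n * Real.log ((u - n) / u)
      = ∑ i ∈ K.1, v i + n * ((1 - m) + Real.log ((u - n) / u)) by ring, Real.exp_add,
      Real.exp_nat_mul, Real.exp_add, Real.exp_log (by positivity)]
  simp_rw [hsplit]
  rw [integral_mul_const]
  refine (mul_le_mul_of_nonneg_right (integral_exp_sum_keySet_le hn v) (by positivity)).trans ?_
  rw [← mul_pow]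
  refine pow_le_one₀ (mul_nonneg (div_nonneg (Finset.sum_nonneg fun i _ => (Real.exp_pos _).le)
    hpos.le) (by positivity)) ?_
  have h1 : (∑ i, Real.exp (v i)) / (u - n) * (Real.exp (1 - m) * ((u - n) / u))
      = m * Real.exp (1 - m) := by rw [hm]; field_simp
  rw [h1]
  have h2 : m ≤ Real.exp (m - 1) := by linarith [Real.add_one_le_exp (m - 1)]
  calc m * Real.exp (1 - m) ≤ Real.exp (m - 1) * Real.exp (1 - m) :=
        mul_le_mul_of_nonneg_right h2 (Real.exp_pos _).le
    _ = 1 := by rw [← Real.exp_add]; simp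

end KeySet

/-! ### Finite-size converse -/

theorem integral_bind_kernel {α β : Type*} [MeasurableSpace α] [MeasurableSpace β] {μ : Measure α}
    [SFinite μ] {κ : Kernel α β} [IsSFiniteKernel κ] {f : β → ℝ} (hf : Integrable f (μ.bind κ)) :
    ∫ y, f y ∂(μ.bind κ) = ∫ x, ∫ y, f y ∂κ x ∂μ := by
  rw [Measure.comp_eq_comp_const_apply] at hf ⊢
  rw [Kernel.integral_comp hf]
  simp

namespace MembershipTester

open InformationTheory

variable {u n : ℕ} (M : MembershipTester u n)

instance isProbabilityMeasure_stateLaw (K : KeySet u n) : IsProbabilityMeasure (M.stateLaw K) :=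
  inferInstanceAs (IsProbabilityMeasure (M.rand ⊗ₘ M.init K))

instance isProbabilityMeasure_queryLaw (K : KeySet u n) (i : Fin u) :
    IsProbabilityMeasure (M.queryLaw K i) :=
  inferInstanceAs (IsProbabilityMeasure ((M.stateLaw K).bind (M.query i)))

/-- The conditional mean of `f` of the answer to a query, given the state of the tester. -/
noncomputable def meanScore (f : unitInterval → ℝ) (s : M.Rand × M.Mem) (i : Fin u) : ℝ :=
  ∫ x, f x ∂M.query i s

variable {M} {f : unitInterval → ℝ} {C : ℝ}

theorem measurable_meanScore (hf : Measurable f) (i : Fin u) :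
    Measurable fun s => M.meanScore f s i :=
  (hf.stronglyMeasurable.integral_kernel (κ := M.query i)).measurable

theorem abs_meanScore_le (hC : ∀ x, |f x| ≤ C) (s : M.Rand × M.Mem) (i : Fin u) :
    |M.meanScore f s i| ≤ C := by
  have h := norm_integral_le_of_norm_le_const (μ := M.query i s) (f := f)
    (Eventually.of_forall hC)
  simpa [meanScore] using h

theorem integral_meanScore (hf : Measurable f) (hC : ∀ x, |f x| ≤ C) (K : KeySet u n)
    (i : Fin u) : ∫ s, M.meanScore f s i ∂M.stateLaw K = ∫ x, f x ∂M.queryLaw K i := by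
  have hi : Integrable f (M.queryLaw K i) := integrable_of_abs_le hf hC
  exact (integral_bind_kernel hi).symm

/-- Jensen's inequality. It disposes of the private randomness of queries: conditional means leave
the linear term exact and only decrease the exponential one. -/
theorem exp_meanScore_le (hf : Measurable f) (hC : ∀ x, |f x| ≤ C) (s : M.Rand × M.Mem)
    (i : Fin u) : Real.exp (M.meanScore f s i) ≤ M.meanScore (fun x => Real.exp (f x)) s i :=
  convexOn_exp.map_integral_le Real.continuous_exp.continuousOn isClosed_univ
    (Eventually.of_forall fun _ => Set.mem_univ _) (integrable_of_abs_le hf hC)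
    (integrable_exp_of_abs_le hf hC)

theorem integrable_exp_meanScore (hf : Measurable f) (hC : ∀ x, |f x| ≤ C) (K : KeySet u n)
    (i : Fin u) : Integrable (fun s => Real.exp (M.meanScore f s i)) (M.stateLaw K) :=
  integrable_exp_of_abs_le (measurable_meanScore hf i) fun s => abs_meanScore_le hC s i

theorem abs_exp_le (hC : ∀ x, |f x| ≤ C) (x : unitInterval) : |Real.exp (f x)| ≤ Real.exp C := by
  rw [Real.abs_exp]
  exact Real.exp_le_exp.2 ((le_abs_self _).trans (hC x))

theorem integral_exp_meanScore_le (hf : Measurable f) (hC : ∀ x, |f x| ≤ C) (K : KeySet u n)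
    (i : Fin u) : ∫ s, Real.exp (M.meanScore f s i) ∂M.stateLaw K
      ≤ ∫ x, Real.exp (f x) ∂M.queryLaw K i := by
  rw [← integral_meanScore hf.exp (abs_exp_le hC)]
  exact integral_mono (integrable_exp_meanScore hf hC K i)
    (integrable_of_abs_le (measurable_meanScore hf.exp i) fun s =>
      abs_meanScore_le (abs_exp_le hC) s i) fun s => exp_meanScore_le hf hC s i

theorem sum_integral_exp_queryLaw (hM : M.PermInvariant) (K : KeySet u n) (g : unitInterval → ℝ) :
    ∑ i, ∫ x, g x ∂M.queryLaw K i
      = n * ∫ x, g x ∂M.keyLaw + (u - n) * ∫ x, g x ∂M.nonkeyLaw := by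
  have hle : n ≤ u := by
    rw [← K.2]
    exact (Finset.card_le_univ K.1).trans_eq (Fintype.card_fin u)
  rw [← Finset.sum_add_sum_compl K.1,
    Finset.sum_congr rfl fun i hi => by rw [← keyLaw_eq_queryLaw hM hi],
    Finset.sum_congr (s₁ := K.1ᶜ) rfl fun i hi => by
      rw [← nonkeyLaw_eq_queryLaw hM (Finset.mem_compl.1 hi)]]
  rw [Finset.sum_const, Finset.sum_const, Finset.card_compl, K.2, Fintype.card_fin]
  simp [Nat.cast_sub hle]

/-- By permutation invariance every key contributes the same mean, and a uniform element of `[u]` is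
a key with weight `n/u`, whence the mixture of the two answer laws in the exponential term. -/
theorem integral_keyExponent_ge (hM : M.PermInvariant) (hn : n < u) (hf : Measurable f)
    (hC : ∀ x, |f x| ≤ C) (K : KeySet u n) :
    n * (∫ x, f x ∂M.keyLaw + 1 - (n / u * ∫ x, Real.exp (f x) ∂M.keyLaw
        + (1 - n / u) * ∫ x, Real.exp (f x) ∂M.nonkeyLaw) + Real.log (1 - n / u))
      ≤ ∫ s, keyExponent K (M.meanScore f s) ∂M.stateLaw K := by
  have hu : (0 : ℝ) < u := by exact_mod_cast (Nat.zero_le n).trans_lt hn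
  have hi1 : ∀ i, Integrable (fun s => M.meanScore f s i) (M.stateLaw K) := fun i =>
    integrable_of_abs_le (measurable_meanScore hf i) fun s => abs_meanScore_le hC s i
  have hi2 := integrable_exp_meanScore (M := M) hf hC K
  have hS1 : Integrable (fun s => ∑ i ∈ K.1, M.meanScore f s i) (M.stateLaw K) :=
    integrable_finsetSum _ fun i _ => hi1 i
  have hS2 : Integrable (fun s => ∑ i, Real.exp (M.meanScore f s i)) (M.stateLaw K) :=
    integrable_finsetSum _ fun i _ => hi2 i
  have hS3 : Integrable (fun s => (n : ℝ) * ((∑ i, Real.exp (M.meanScore f s i)) / u - 1))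
      (M.stateLaw K) := ((hS2.div_const _).sub (integrable_const 1)).const_mul _
  have e1 : ∫ s, ∑ i ∈ K.1, M.meanScore f s i ∂M.stateLaw K = n * ∫ x, f x ∂M.keyLaw := by
    rw [integral_finsetSum _ fun i _ => hi1 i]
    rw [Finset.sum_congr rfl fun i hi => by
      rw [integral_meanScore hf hC, ← keyLaw_eq_queryLaw hM hi]]
    rw [Finset.sum_const, K.2, nsmul_eq_mul]
  have e2 : ∫ s, ∑ i, Real.exp (M.meanScore f s i) ∂M.stateLaw K
      ≤ n * ∫ x, Real.exp (f x) ∂M.keyLaw + (u - n) * ∫ x, Real.exp (f x) ∂M.nonkeyLaw := by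
    rw [integral_finsetSum _ fun i _ => hi2 i,
      ← sum_integral_exp_queryLaw hM K fun x => Real.exp (f x)]
    exact Finset.sum_le_sum fun i _ => integral_exp_meanScore_le hf hC K i
  have e3 : ∫ s, keyExponent K (M.meanScore f s) ∂M.stateLaw K
      = n * ∫ x, f x ∂M.keyLaw
        - n * ((∫ s, ∑ i, Real.exp (M.meanScore f s i) ∂M.stateLaw K) / u - 1)
        + n * Real.log (1 - n / u) := by
    have hS4 : Integrable (fun s => ∑ i ∈ K.1, M.meanScore f s i
        - n * ((∑ i, Real.exp (M.meanScore f s i)) / u - 1)) (M.stateLaw K) := hS1.sub hS3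
    unfold keyExponent
    rw [integral_add hS4 (integrable_const _), integral_sub hS1 hS3, e1,
      integral_const_mul, integral_sub (hS2.div_const _) (integrable_const 1), integral_div]
    simp
  have e4 : (∫ s, ∑ i, Real.exp (M.meanScore f s i) ∂M.stateLaw K) / u
      ≤ n / u * ∫ x, Real.exp (f x) ∂M.keyLaw
        + (1 - n / u) * ∫ x, Real.exp (f x) ∂M.nonkeyLaw := by
    rw [div_le_iff₀ hu]
    refine e2.trans_eq ?_
    field_simp
  rw [e3]
  have := mul_le_mul_of_nonneg_left e4 (Nat.cast_nonneg (α := ℝ) n)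
  linarith

theorem abs_keyExponent_le (K : KeySet u n) {v : Fin u → ℝ} (hv : ∀ i, |v i| ≤ C) :
    |keyExponent K v| ≤ n * C + n * (Real.exp C + 1) + |n * Real.log (1 - n / u)| := by
  have h1 : |∑ i ∈ K.1, v i| ≤ n * C := by
    refine (Finset.abs_sum_le_sum_abs _ _).trans ((Finset.sum_le_sum fun i _ => hv i).trans_eq ?_)
    rw [Finset.sum_const, K.2, nsmul_eq_mul]
  have h2 : |(∑ i, Real.exp (v i)) / u| ≤ Real.exp C := by
    have h0 : 0 ≤ ∑ i, Real.exp (v i) := Finset.sum_nonneg fun i _ => (Real.exp_pos _).le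
    rw [abs_of_nonneg (div_nonneg h0 (Nat.cast_nonneg _))]
    refine div_le_of_le_mul₀ (Nat.cast_nonneg _) (Real.exp_pos _).le ?_
    refine (Finset.sum_le_sum fun i _ => Real.exp_le_exp.2
      ((le_abs_self _).trans (hv i))).trans_eq ?_
    rw [Finset.sum_const, Finset.card_univ, Fintype.card_fin, nsmul_eq_mul, mul_comm]
  have h3 : |(n : ℝ) * ((∑ i, Real.exp (v i)) / u - 1)| ≤ n * (Real.exp C + 1) := by
    rw [abs_mul, Nat.abs_cast]
    refine mul_le_mul_of_nonneg_left ((abs_sub _ _).trans ?_) (Nat.cast_nonneg _)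
    rw [abs_one]
    linarith
  unfold keyExponent
  exact (abs_add_le _ _).trans (add_le_add ((abs_sub _ _).trans (add_le_add h1 h3)) le_rfl)

/-- The finite-size converse: the information that the state carries about the keys is bounded below
by the dual functional of the laws of the answers. -/
theorem ofReal_le_klDiv_jointLaw (hM : M.PermInvariant) (hn : n < u) (hf : Measurable f)
    (hC : ∀ x, |f x| ≤ C) :
    ENNReal.ofReal (n * (∫ x, f x ∂M.keyLaw + 1 - (n / u * ∫ x, Real.exp (f x) ∂M.keyLaw
        + (1 - n / u) * ∫ x, Real.exp (f x) ∂M.nonkeyLaw) + Real.log (1 - n / u)))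
      ≤ klDiv M.jointLaw (M.jointLaw.fst.prod M.jointLaw.snd) := by
  have hp := isProbabilityMeasure_uniformOn_keySet (u := u) (n := n) hn.le
  have hγ : IsProbabilityMeasure M.jointLaw := by unfold jointLaw; infer_instance
  let F : KeySet u n × (M.Rand × M.Mem) → ℝ := fun q => keyExponent q.1 (M.meanScore f q.2)
  have hFm : Measurable F := by
    refine measurable_from_prod_countable_right fun K => ?_
    change Measurable fun s => keyExponent K (M.meanScore f s)
    unfold keyExponent
    have := measurable_meanScore (M := M) hf
    fun_prop
  have hFC : ∀ q, |F q| ≤ n * C + n * (Real.exp C + 1) + |n * Real.log (1 - n / u)| := fun q =>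
    abs_keyExponent_le q.1 fun i => abs_meanScore_le hC q.2 i
  have hfst : M.jointLaw.fst = uniformOn Set.univ := by unfold jointLaw; simp
  -- Fubini with the key set innermost: the state, hence the score vector, is fixed while `K` is
  -- uniform.
  have hexp : ∫ q, Real.exp (F q) ∂(M.jointLaw.fst.prod M.jointLaw.snd) ≤ 1 := by
    rw [integral_prod_symm _ (integrable_exp_of_abs_le hFm hFC), hfst]
    refine (integral_mono_of_nonneg (Eventually.of_forall fun s => integral_nonneg fun K =>
      (Real.exp_pos _).le) (integrable_const 1) (Eventually.of_forall fun s =>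
        integral_exp_keyExponent_le_one hn (M.meanScore f s))).trans_eq (by simp)
  refine le_trans (ENNReal.ofReal_le_ofReal ?_)
    (integral_le_klDiv_of_integral_exp_le_one hFm hFC hexp)
  have hint : Integrable F M.jointLaw := integrable_of_abs_le hFm hFC
  unfold jointLaw at hint ⊢
  rw [Measure.integral_compProd hint]
  refine le_trans (le_of_eq ?_) (integral_mono (integrable_const _) Integrable.of_finite
    fun K => integral_keyExponent_ge hM hn hf hC K)
  simp

end MembershipTester

/-! ### Passage to the limit -/

theorem mem_feasible_of_tendsto {ι : Type*} {l : Filter ι} [l.NeBot] {d : unitInterval → ℝ≥0∞}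
    (hd : LowerSemicontinuous d) {ε : ℝ≥0} {e : ι → ℝ≥0∞} (he : limsup e l ≤ ε)
    {P : ι → ProbabilityMeasure unitInterval} {μ : ProbabilityMeasure unitInterval}
    (hP : Tendsto P l (𝓝 μ)) (h : ∀ᶠ j in l, ∫⁻ x, d x ∂(P j : Measure unitInterval) ≤ e j) :
    μ ∈ feasible d ε := by
  refine ENNReal.le_of_forall_pos_le_add fun δ hδ _ => ?_
  have hlt : limsup e l < ε + δ :=
    he.trans_lt (ENNReal.lt_add_right ENNReal.coe_ne_top (ENNReal.coe_ne_zero.2 hδ.ne'))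
  refine (isClosed_feasible hd (ε + δ)).mem_of_tendsto hP ?_
  filter_upwards [h, eventually_lt_of_limsup_lt hlt] with j hj hj'
  exact hj.trans hj'.le

/-- The answer laws are only known to be probability measures for large indices; a dummy value at
the others gives a total sequence in the compact space. -/
theorem exists_probabilityMeasure_coe_eq (μ : Measure unitInterval) :
    ∃ P : ProbabilityMeasure unitInterval, IsProbabilityMeasure μ → (P : Measure unitInterval) = μ := by
  by_cases h : IsProbabilityMeasure μ
  · exact ⟨⟨μ, h⟩, fun _ => rfl⟩
  · exact ⟨diracProba 0, fun h' => absurd h' h⟩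

namespace MembershipTester

open InformationTheory

variable {u n : ℕ} {M : MembershipTester u n}

theorem isProbabilityMeasure_keyLaw (hM : M.PermInvariant) (hn : 0 < n) (hu : n < u) :
    IsProbabilityMeasure M.keyLaw := by
  obtain ⟨K⟩ := nonempty_keySet hu.le
  obtain ⟨i, hi⟩ : K.1.Nonempty := Finset.card_pos.1 (by rw [K.2]; exact hn)
  rw [keyLaw_eq_queryLaw hM hi]
  infer_instance

theorem exists_notMem_keySet (hu : n < u) (K : KeySet u n) : ∃ i, i ∉ K.1 := by
  by_contra! h
  have h2 : K.1 = Finset.univ := Finset.eq_univ_iff_forall.2 h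
  have h3 := K.2
  rw [h2, Finset.card_univ, Fintype.card_fin] at h3
  omega

theorem isProbabilityMeasure_nonkeyLaw (hM : M.PermInvariant) (hu : n < u) :
    IsProbabilityMeasure M.nonkeyLaw := by
  obtain ⟨K⟩ := nonempty_keySet hu.le
  obtain ⟨i, hi⟩ := exists_notMem_keySet hu K
  rw [nonkeyLaw_eq_queryLaw hM hi]
  infer_instance

theorem ofReal_log_two_ne_top_and_ne_zero : ENNReal.ofReal (Real.log 2) ≠ ∞ ∧ ENNReal.ofReal (Real.log 2) ≠ 0 :=
  ⟨ENNReal.ofReal_ne_top, by simpa using Real.log_pos one_lt_two⟩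

/-- The converse per key and in nats, arranged as the dual functional plus corrections that vanish
as `n/u → 0`. -/
theorem le_of_memoryBudget_div_le (hM : M.PermInvariant) (hn : 0 < n) (hu : n < u)
    (g : BoundedContinuousFunction unitInterval ℝ) {c : ℝ≥0∞} (hc : c ≠ ∞)
    (h : M.memoryBudget / n ≤ c) :
    klDual g M.keyLaw M.nonkeyLaw - n / u * (∫ x, Real.exp (g x) ∂M.keyLaw
        - ∫ x, Real.exp (g x) ∂M.nonkeyLaw) + Real.log (1 - n / u)
      ≤ (c * ENNReal.ofReal (Real.log 2)).toReal := by
  have hn0 : (n : ℝ≥0∞) ≠ 0 := by exact_mod_cast hn.ne'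
  have hkl := ofReal_le_klDiv_jointLaw hM hu (measurable_boundedContinuousFunction g)
    (abs_boundedContinuousFunction_le g)
  have h1 : klDiv M.jointLaw (M.jointLaw.fst.prod M.jointLaw.snd)
      ≤ n * (c * ENNReal.ofReal (Real.log 2)) := by
    have h2 := (ENNReal.div_le_iff hn0 (ENNReal.natCast_ne_top n)).1 h
    unfold memoryBudget mutualInfoBits klBits at h2
    have h3 := (ENNReal.div_le_iff ofReal_log_two_ne_top_and_ne_zero.2 ofReal_log_two_ne_top_and_ne_zero.1).1 h2
    refine h3.trans_eq ?_
    ring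
  have h4 := hkl.trans h1
  have hfin : c * ENNReal.ofReal (Real.log 2) ≠ ∞ := ENNReal.mul_ne_top hc ofReal_log_two_ne_top_and_ne_zero.1
  have h5 := (ENNReal.ofReal_le_iff_le_toReal (ENNReal.mul_ne_top (ENNReal.natCast_ne_top n)
    hfin)).1 h4
  rw [ENNReal.toReal_mul, ENNReal.toReal_natCast] at h5
  have h6 := le_of_mul_le_mul_left h5 (by exact_mod_cast hn : (0 : ℝ) < n)
  refine le_trans (le_of_eq ?_) h6
  rw [klDual]
  ring

end MembershipTester

open MembershipTester InformationTheory in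
theorem le_liminf_memoryBudget_div {dK dN : unitInterval → ℝ≥0∞} (hd : AdmissibleErrors dK dN)
    {εK εN : ℝ≥0} {V : ℝ≥0∞}
    (hV : ∀ νK ∈ feasible dK εK, ∀ νN ∈ feasible dN εN,
      V ≤ klBits (νK : Measure unitInterval) (νN : Measure unitInterval))
    {n u : ℕ → ℕ} {M : ∀ j, MembershipTester (u j) (n j)} {eK eN : ℕ → ℝ≥0∞}
    (hu : ∀ j, 0 < u j) (hn : Tendsto n atTop atTop)
    (hnu : Tendsto (fun j => (n j : ℝ) / (u j : ℝ)) atTop (𝓝 0))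
    (hM : ∀ j, (M j).PermInvariant)
    (herr : ∀ j, (M j).AchievesError dK dN (eK j) (eN j))
    (heK : limsup eK atTop ≤ εK) (heN : limsup eN atTop ≤ εN) :
    V ≤ liminf (fun j => (M j).memoryBudget / (n j : ℝ≥0∞)) atTop := by
  by_contra! hlt
  obtain ⟨w, hw1, hw2⟩ := exists_between hlt
  have hfreq := frequently_lt_of_liminf_lt (by isBoundedDefault) hw1
  have hne := frequently_mem_iff_neBot.1 hfreq
  -- An ultrafilter concentrated on the indices with budget per key below `w` plays the role of a
  -- subsequence along which both answer laws converge.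
  set U : Ultrafilter ℕ := @Ultrafilter.of _ _ hne with hU
  have hUle : (U : Filter ℕ) ≤ atTop ⊓ 𝓟 _ := @Ultrafilter.of_le _ _ hne
  have hUtop : (U : Filter ℕ) ≤ atTop := hUle.trans inf_le_left
  have hUw : ∀ᶠ j in (U : Filter ℕ), (M j).memoryBudget / (n j : ℝ≥0∞) < w :=
    (hUle.trans inf_le_right) (mem_principal_self _)
  have hgood : ∀ᶠ j in (U : Filter ℕ), 0 < n j ∧ n j < u j := by
    apply hUtop
    filter_upwards [hn.eventually_gt_atTop 0, hnu.eventually_lt_const one_pos] with j h1 h2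
    refine ⟨h1, ?_⟩
    rw [div_lt_one (by exact_mod_cast hu j)] at h2
    exact_mod_cast h2
  choose PK hPK' using fun j => exists_probabilityMeasure_coe_eq (M j).keyLaw
  choose PN hPN' using fun j => exists_probabilityMeasure_coe_eq (M j).nonkeyLaw
  have hPK : ∀ᶠ j in (U : Filter ℕ), (PK j : Measure unitInterval) = (M j).keyLaw :=
    hgood.mono fun j hj => hPK' j (isProbabilityMeasure_keyLaw (hM j) hj.1 hj.2)
  have hPN : ∀ᶠ j in (U : Filter ℕ), (PN j : Measure unitInterval) = (M j).nonkeyLaw :=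
    hgood.mono fun j hj => hPN' j (isProbabilityMeasure_nonkeyLaw (hM j) hj.2)
  obtain ⟨μK, -, hμK⟩ := isCompact_univ.ultrafilter_le_nhds (U.map PK) (by simp)
  obtain ⟨μN, -, hμN⟩ := isCompact_univ.ultrafilter_le_nhds (U.map PN) (by simp)
  have hμK : Tendsto PK U (𝓝 μK) := hμK
  have hμN : Tendsto PN U (𝓝 μN) := hμN
  have hfK : μK ∈ feasible dK εK := by
    refine mem_feasible_of_tendsto hd.lsc_key (e := eK) ((limsup_le_limsup_of_le hUtop).trans heK)
      hμK ?_
    filter_upwards [hPK] with j hj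
    rw [hj]
    exact (herr j).1
  have hfN : μN ∈ feasible dN εN := by
    refine mem_feasible_of_tendsto hd.lsc_nonkey (e := eN)
      ((limsup_le_limsup_of_le hUtop).trans heN) hμN ?_
    filter_upwards [hPN] with j hj
    rw [hj]
    exact (herr j).2
  have hwtop : w ≠ ∞ := hw2.ne_top
  have hkl : klDiv (μK : Measure unitInterval) (μN : Measure unitInterval)
      ≤ ENNReal.ofReal (w * ENNReal.ofReal (Real.log 2)).toReal := by
    refine klDiv_le_of_forall_continuous fun g => ?_
    have hp : Tendsto (fun j => (n j : ℝ) / (u j : ℝ)) U (𝓝 0) := hnu.mono_left hUtop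
    have h1 : Tendsto (fun j => klDual g (PK j : Measure unitInterval) (PN j)) U
        (𝓝 (klDual g (μK : Measure unitInterval) μN)) :=
      ((continuous_klDual g).tendsto (μK, μN)).comp (hμK.prodMk_nhds hμN)
    have h2 : Tendsto (fun j => (∫ x, Real.exp (g x) ∂(PK j : Measure unitInterval))
        - ∫ x, Real.exp (g x) ∂(PN j : Measure unitInterval)) U
        (𝓝 ((∫ x, Real.exp (g x) ∂(μK : Measure unitInterval))
          - ∫ x, Real.exp (g x) ∂(μN : Measure unitInterval))) :=
      (((continuous_exp_integral g).tendsto μK).comp hμK).sub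
        (((continuous_exp_integral g).tendsto μN).comp hμN)
    have h3 : Tendsto (fun j => Real.log (1 - (n j : ℝ) / (u j : ℝ))) U (𝓝 0) := by
      have h4 := (hp.const_sub 1).log (by norm_num)
      simpa using h4
    have h5 := (h1.sub (hp.mul h2)).add h3
    rw [zero_mul, sub_zero, add_zero] at h5
    refine le_of_tendsto h5 ?_
    filter_upwards [hPK, hPN, hgood, hUw] with j hjK hjN hj hjw
    rw [hjK, hjN]
    exact le_of_memoryBudget_div_le (hM j) hj.1 hj.2 g hwtop hjw.le
  rw [ENNReal.ofReal_toReal (ENNReal.mul_ne_top hwtop ofReal_log_two_ne_top_and_ne_zero.1)] at hkl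
  have hle : klBits (μK : Measure unitInterval) (μN : Measure unitInterval) ≤ w :=
    (ENNReal.div_le_iff ofReal_log_two_ne_top_and_ne_zero.2 ofReal_log_two_ne_top_and_ne_zero.1).2 hkl
  exact absurd (hV μK hfK μN hfN) (not_le.2 (hle.trans_lt hw2))

/-! ### Divergence from product measures -/

section Auxiliary

open InformationTheory

/-- The second marginal is the best product comparison measure. -/
theorem klDiv_prod_marginals_le {α β : Type*} [MeasurableSpace α] [MeasurableSpace β]
    [StandardBorelSpace α] [Nonempty α] (γ : Measure (α × β)) [IsProbabilityMeasure γ]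
    (Q : Measure β) [IsProbabilityMeasure Q] :
    klDiv γ (γ.fst.prod γ.snd) ≤ klDiv γ (γ.fst.prod Q) := by
  set γ' := γ.map Prod.swap with hγ'
  have hprob : IsProbabilityMeasure γ' :=
    Measure.isProbabilityMeasure_map measurable_swap.aemeasurable
  have hfst : γ'.fst = γ.snd := by rw [hγ', Measure.fst_map_swap]
  have hback : γ'.map Prod.swap = γ := by
    rw [hγ', Measure.map_map measurable_swap measurable_swap]
    simp
  have hdis : γ.snd ⊗ₘ γ'.condKernel = γ' := by
    rw [← hfst]
    exact γ'.disintegrate γ'.condKernel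
  calc klDiv γ (γ.fst.prod γ.snd)
      = klDiv (γ'.map Prod.swap) ((γ.snd.prod γ.fst).map Prod.swap) := by
        rw [hback, Measure.prod_swap]
    _ ≤ klDiv γ' (γ.snd.prod γ.fst) := klDiv_map_le _ _ measurable_swap
    -- After the swap the altered marginal comes first, so the chain rule applies: the right side
    -- exceeds the left by `klDiv γ.snd Q`.
    _ ≤ klDiv γ' (Q.prod γ.fst) := by
        rw [← hdis, ← Measure.compProd_const, ← Measure.compProd_const,
          klDiv_compProd_eq_add γ.snd Q]
        exact le_add_self
    _ = klDiv (γ.map Prod.swap) ((γ.fst.prod Q).map Prod.swap) := by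
        rw [Measure.prod_swap]
    _ ≤ klDiv γ (γ.fst.prod Q) := klDiv_map_le _ _ measurable_swap

theorem measure_pi_withDensity {ι : Type*} [Fintype ι] {X : Type*} [MeasurableSpace X]
    (ρ : ι → Measure X) [∀ i, IsProbabilityMeasure (ρ i)] {g : ι → X → ℝ≥0∞}
    (hg : ∀ i, Measurable (g i)) [∀ i, IsProbabilityMeasure ((ρ i).withDensity (g i))] :
    Measure.pi (fun i => (ρ i).withDensity (g i))
      = (Measure.pi ρ).withDensity fun w => ∏ i, g i (w i) := by
  refine Measure.pi_eq fun s hs => ?_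
  rw [withDensity_apply _ (MeasurableSet.univ_pi hs), ← lintegral_indicator (MeasurableSet.univ_pi hs)]
  have hind : ∀ w : ι → X, (Set.univ.pi s).indicator (fun w => ∏ i, g i (w i)) w
      = ∏ i, (s i).indicator (g i) (w i) := by
    intro w
    by_cases hw : w ∈ Set.univ.pi s
    · rw [Set.indicator_of_mem hw]
      exact Finset.prod_congr rfl fun i _ => (Set.indicator_of_mem (hw i trivial) _).symm
    · rw [Set.indicator_of_notMem hw]
      obtain ⟨i, hi⟩ : ∃ i, w i ∉ s i := by simpa using hw
      exact (Finset.prod_eq_zero (Finset.mem_univ i) (Set.indicator_of_notMem hi _)).symm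
  simp_rw [hind]
  have hm : ∀ i, Measurable ((s i).indicator (g i)) := fun i => (hg i).indicator (hs i)
  rw [lintegral_prod_eq_prod_lintegral_of_indepFun Finset.univ
    (fun i (w : ι → X) => (s i).indicator (g i) (w i))
    (iIndepFun_pi fun i => (hm i).aemeasurable) fun i => (hm i).comp (measurable_pi_apply i)]
  refine Finset.prod_congr rfl fun i _ => ?_
  rw [(measurePreserving_eval ρ i).lintegral_comp (hm i), lintegral_indicator (hs i),
    withDensity_apply _ (hs i)]

/-- The log-density is prescribed only `γ`-almost everywhere, since the logarithm of a product
splits only where no factor vanishes. -/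
theorem klDiv_withDensity {α : Type*} [MeasurableSpace α] {γ ρ : Measure α}
    [IsProbabilityMeasure γ] [IsProbabilityMeasure ρ] {D : α → ℝ≥0∞} (hD : Measurable D)
    (h : γ = ρ.withDensity D) {G : α → ℝ} (hG : Integrable G γ)
    (hlog : ∀ᵐ x ∂γ, Real.log (D x).toReal = G x) :
    klDiv γ ρ = ENNReal.ofReal (∫ x, G x ∂γ) := by
  have hac : γ ≪ ρ := h ▸ withDensity_absolutelyContinuous _ _
  have hr : γ.rnDeriv ρ =ᵐ[ρ] D := by
    rw [h]
    exact Measure.rnDeriv_withDensity ρ hD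
  have hllr : llr γ ρ =ᵐ[γ] G := by
    filter_upwards [hac.ae_le hr, hlog] with x h1 h2
    rw [llr_def, ← h2, ← h1]
  rw [klDiv_of_ac_of_integrable hac (hG.congr hllr.symm), integral_congr_ae hllr]
  simp

end Auxiliary

/-! ### The optimal tester: a table of independent scores -/

namespace MembershipTester

open InformationTheory

variable {u n : ℕ} (μK μN : ProbabilityMeasure unitInterval)

/-- The law of the score stored for `i` by the tester that draws scores independently. -/
noncomputable def scoreLaw (K : KeySet u n) (i : Fin u) : Measure unitInterval :=
  if i ∈ K.1 then μK else μN

instance (K : KeySet u n) (i : Fin u) : IsProbabilityMeasure (scoreLaw μK μN K i) := by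
  unfold scoreLaw
  split_ifs <;> infer_instance

/-- The tester whose memory is a table of independent scores, of law `μK` for the keys and `μN` for
the other elements. -/
noncomputable def tableTester (u n : ℕ) : MembershipTester u n where
  Rand := Unit
  Mem := Fin u → unitInterval
  rand := Measure.dirac ()
  init K := Kernel.const _ (Measure.pi (scoreLaw μK μN K))
  query i := Kernel.deterministic (fun s => s.2 i) ((measurable_pi_apply i).comp measurable_snd)

/-- The law of (trivial randomness, table of scores) when the key set is `K`. -/
noncomputable def tableLaw (K : KeySet u n) : Measure (Unit × (Fin u → unitInterval)) :=
  (Measure.dirac ()) ⊗ₘ (Kernel.const _ (Measure.pi (scoreLaw μK μN K)))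

instance (K : KeySet u n) : IsProbabilityMeasure (tableLaw μK μN K) := by
  unfold tableLaw; infer_instance

/-- `tableLaw` as a Markov kernel. -/
noncomputable def tableKernel (u n : ℕ) : Kernel (KeySet u n) (Unit × (Fin u → unitInterval)) :=
  ⟨tableLaw μK μN, measurable_of_countable _⟩

instance : IsMarkovKernel (tableKernel μK μN u n) :=
  ⟨fun K => inferInstanceAs (IsProbabilityMeasure (tableLaw μK μN K))⟩

/-- The joint law of the key set and the table of scores. -/
noncomputable def tableJoint (u n : ℕ) : Measure (KeySet u n × (Unit × (Fin u → unitInterval))) :=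
  (uniformOn Set.univ) ⊗ₘ tableKernel μK μN u n

theorem memoryBudget_tableTester :
    (tableTester μK μN u n).memoryBudget = mutualInfoBits (tableJoint μK μN u n) := rfl

theorem tableLaw_eq_prod (K : KeySet u n) : tableLaw μK μN K
    = (Measure.dirac ()).prod (Measure.pi (scoreLaw μK μN K)) :=
  Measure.compProd_const

theorem measurePreserving_tableLaw (K : KeySet u n) (i : Fin u) :
    MeasurePreserving (fun s : Unit × (Fin u → unitInterval) => s.2 i)
      (tableLaw μK μN K) (scoreLaw μK μN K i) := by
  rw [tableLaw_eq_prod]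
  exact (measurePreserving_eval _ i).comp measurePreserving_snd

theorem queryLaw_tableTester (K : KeySet u n) (i : Fin u) :
    (tableTester μK μN u n).queryLaw K i = scoreLaw μK μN K i := by
  have h := measurePreserving_tableLaw μK μN K i
  rw [← h.map_eq]
  exact Measure.deterministic_comp_eq_map h.measurable

theorem permInvariant_tableTester : (tableTester μK μN u n).PermInvariant := by
  intro π K i
  rw [queryLaw_tableTester, queryLaw_tableTester]
  have : π i ∈ (K.perm π).1 ↔ i ∈ K.1 := by simp [KeySet.perm]
  unfold scoreLaw
  simp only [this]

theorem keyLaw_tableTester (hn : 0 < n) (hu : n < u) :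
    (tableTester μK μN u n).keyLaw = μK := by
  obtain ⟨K⟩ := nonempty_keySet hu.le
  obtain ⟨i, hi⟩ : K.1.Nonempty := Finset.card_pos.1 (by rw [K.2]; exact hn)
  rw [keyLaw_eq_queryLaw (permInvariant_tableTester μK μN) hi, queryLaw_tableTester, scoreLaw,
    if_pos hi]

theorem nonkeyLaw_tableTester (hu : n < u) : (tableTester μK μN u n).nonkeyLaw = μN := by
  obtain ⟨K⟩ := nonempty_keySet hu.le
  obtain ⟨i, hi⟩ := exists_notMem_keySet hu K
  rw [nonkeyLaw_eq_queryLaw (permInvariant_tableTester μK μN) hi, queryLaw_tableTester, scoreLaw,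
    if_neg hi]

/-- The likelihood ratio of the table of scores for the key set `K` against a table of non-key
scores. -/
noncomputable def tableDensity (K : KeySet u n) (s : Unit × (Fin u → unitInterval)) : ℝ≥0∞ :=
  ∏ i ∈ K.1, (μK : Measure unitInterval).rnDeriv μN (s.2 i)

/-- The law of a table of non-key scores. -/
noncomputable def nonkeyTable (u : ℕ) : Measure (Unit × (Fin u → unitInterval)) :=
  (Measure.dirac ()).prod (Measure.pi fun _ => (μN : Measure unitInterval))

instance : IsProbabilityMeasure (nonkeyTable μN u) := by unfold nonkeyTable; infer_instance

theorem measurable_tableDensity :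
    Measurable (Function.uncurry (tableDensity (u := u) (n := n) μK μN)) := by
  refine measurable_from_prod_countable_right fun K => ?_
  change Measurable (tableDensity μK μN K)
  unfold tableDensity
  exact Finset.measurable_prod _ fun i _ => (Measure.measurable_rnDeriv _ _).comp
    ((measurable_pi_apply i).comp measurable_snd)

variable {μK μN}

theorem tableLaw_eq_withDensity
    (hac : (μK : Measure unitInterval) ≪ (μN : Measure unitInterval)) (K : KeySet u n) :
    tableLaw μK μN K = (nonkeyTable μN u).withDensity (tableDensity μK μN K) := by
  -- Against `μN` the non-key coordinates have density 1, so only the `n` keys enter the likelihood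
  -- ratio.
  let g : Fin u → unitInterval → ℝ≥0∞ := fun i =>
    if i ∈ K.1 then (μK : Measure unitInterval).rnDeriv μN else 1
  have hg : ∀ i, Measurable (g i) := by
    intro i
    by_cases hi : i ∈ K.1
    · simpa [g, hi] using Measure.measurable_rnDeriv _ _
    · simpa [g, hi] using measurable_one
  have hlaw : ∀ i, (μN : Measure unitInterval).withDensity (g i) = scoreLaw μK μN K i := by
    intro i
    by_cases hi : i ∈ K.1
    · simp only [g, scoreLaw, if_pos hi]
      exact Measure.withDensity_rnDeriv_eq _ _ hac
    · simp [g, scoreLaw, if_neg hi]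
  have hp : ∀ i, IsProbabilityMeasure ((μN : Measure unitInterval).withDensity (g i)) := fun i => by
    rw [hlaw i]; infer_instance
  have hpi := measure_pi_withDensity (fun _ : Fin u => (μN : Measure unitInterval)) hg
  simp_rw [hlaw] at hpi
  have hprod : ∀ w : Fin u → unitInterval, ∏ i, g i (w i) = tableDensity μK μN K ((), w) := by
    intro w
    rw [tableDensity, ← Finset.prod_subset (Finset.subset_univ K.1)]
    · exact Finset.prod_congr rfl fun i hi => by simp [g, hi]
    · intro i _ hi
      simp [g, hi]
  have hm : Measurable fun w => tableDensity μK μN K ((), w) :=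
    (measurable_tableDensity μK μN).comp (by fun_prop : Measurable fun w => (K, ((), w)))
  simp_rw [hprod] at hpi
  rw [tableLaw_eq_prod, hpi, nonkeyTable, prod_withDensity_right hm]

theorem tableJoint_eq_withDensity (hac : (μK : Measure unitInterval) ≪ (μN : Measure unitInterval)) :
    (tableJoint μK μN u n)
      = ((uniformOn Set.univ).prod (nonkeyTable μN u)).withDensity
        fun q => tableDensity μK μN q.1 q.2 := by
  have hk : tableKernel μK μN u n
      = (Kernel.const _ (nonkeyTable μN u)).withDensity (tableDensity μK μN) := by
    ext1 K
    rw [Kernel.withDensity_apply _ (measurable_tableDensity μK μN), Kernel.const_apply]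
    exact tableLaw_eq_withDensity hac K
  have hs : IsSFiniteKernel ((Kernel.const (KeySet u n) (nonkeyTable μN u)).withDensity
      (tableDensity μK μN)) := by
    rw [← hk]; infer_instance
  have hf : SFinite (uniformOn (Set.univ : Set (KeySet u n))) := by
    unfold uniformOn; infer_instance
  rw [tableJoint, hk, Measure.compProd_withDensity (measurable_tableDensity μK μN),
    Measure.compProd_const]

/-- The log-likelihood ratio of the scores of the keys. -/
noncomputable def keyLlr (μK μN : ProbabilityMeasure unitInterval)
    (q : KeySet u n × (Unit × (Fin u → unitInterval))) : ℝ :=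
  ∑ i ∈ q.1.1, llr (μK : Measure unitInterval) μN (q.2.2 i)

theorem measurable_keyLlr : Measurable (keyLlr (u := u) (n := n) μK μN) := by
  refine measurable_from_prod_countable_right fun K => ?_
  change Measurable fun s : Unit × (Fin u → unitInterval) =>
    ∑ i ∈ K.1, llr (μK : Measure unitInterval) μN (s.2 i)
  exact Finset.measurable_sum _ fun i _ => (measurable_llr _ _).comp
    ((measurable_pi_apply i).comp measurable_snd)

theorem measurePreserving_tableLaw_key {K : KeySet u n} {i : Fin u} (hi : i ∈ K.1) :
    MeasurePreserving (fun s : Unit × (Fin u → unitInterval) => s.2 i)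
      (tableLaw μK μN K) μK := by
  have h := measurePreserving_tableLaw μK μN K i
  rwa [scoreLaw, if_pos hi] at h

theorem integrable_llr_score (hint : Integrable (llr (μK : Measure unitInterval) μN) μK)
    {K : KeySet u n} {i : Fin u} (hi : i ∈ K.1) :
    Integrable (fun s : Unit × (Fin u → unitInterval) =>
      llr (μK : Measure unitInterval) μN (s.2 i)) (tableLaw μK μN K) :=
  (measurePreserving_tableLaw_key hi).integrable_comp_of_integrable hint

theorem integral_keyLlr_tableLaw (hint : Integrable (llr (μK : Measure unitInterval) μN) μK)
    (K : KeySet u n) :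
    ∫ s, keyLlr μK μN (K, s) ∂(tableLaw μK μN K)
      = n * ∫ x, llr (μK : Measure unitInterval) μN x ∂(μK : Measure unitInterval) := by
  unfold keyLlr
  rw [integral_finsetSum _ fun i hi => integrable_llr_score hint hi]
  have hterm : ∀ i ∈ K.1, ∫ s : Unit × (Fin u → unitInterval),
      llr (μK : Measure unitInterval) μN (s.2 i) ∂(tableLaw μK μN K)
        = ∫ x, llr (μK : Measure unitInterval) μN x ∂(μK : Measure unitInterval) := by
    intro i hi
    have h := measurePreserving_tableLaw_key (μK := μK) (μN := μN) hi
    rw [← h.map_eq, integral_map h.measurable.aemeasurable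
      (measurable_llr _ _).aestronglyMeasurable, h.map_eq]
  rw [Finset.sum_congr rfl hterm, Finset.sum_const, K.2, nsmul_eq_mul]

theorem integrable_keyLlr (hu : n < u)
    (hint : Integrable (llr (μK : Measure unitInterval) μN) μK) :
    Integrable (keyLlr μK μN) (tableJoint μK μN u n) := by
  have hp := isProbabilityMeasure_uniformOn_keySet (u := u) (n := n) hu.le
  unfold tableJoint
  rw [Measure.integrable_compProd_iff measurable_keyLlr.aestronglyMeasurable]
  exact ⟨Eventually.of_forall fun K => integrable_finsetSum _ fun i hi =>
    integrable_llr_score hint hi, Integrable.of_finite⟩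

theorem log_tableDensity_ae_eq (hu : n < u)
    (hac : (μK : Measure unitInterval) ≪ (μN : Measure unitInterval)) :
    ∀ᵐ q ∂(tableJoint μK μN u n),
      Real.log (tableDensity μK μN q.1 q.2).toReal = keyLlr μK μN q := by
  have hp := isProbabilityMeasure_uniformOn_keySet (u := u) (n := n) hu.le
  unfold tableJoint
  refine (Measure.ae_compProd_iff (measurableSet_eq_fun
    (measurable_tableDensity μK μN).ennreal_toReal.log measurable_keyLlr)).2
    (Eventually.of_forall fun K => ?_)
  have hpos : ∀ᵐ x ∂(μK : Measure unitInterval),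
      ((μK : Measure unitInterval).rnDeriv μN x).toReal ≠ 0 := by
    filter_upwards [Measure.rnDeriv_pos hac, hac.ae_le (Measure.rnDeriv_lt_top (μK : Measure unitInterval) μN)] with x h1 h2
    exact (ENNReal.toReal_pos h1.ne' h2.ne).ne'
  have hall : ∀ᵐ s ∂(tableLaw μK μN K), ∀ i ∈ K.1,
      ((μK : Measure unitInterval).rnDeriv μN (s.2 i)).toReal ≠ 0 :=
    (ae_ball_iff K.1.countable_toSet).2 fun i hi =>
      (measurePreserving_tableLaw_key hi).quasiMeasurePreserving.ae hpos
  filter_upwards [hall] with s hs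
  change Real.log (∏ i ∈ K.1, (μK : Measure unitInterval).rnDeriv μN (s.2 i)).toReal = _
  rw [ENNReal.toReal_prod, Real.log_prod hs]
  rfl

/-- The true marginal of the table is a mixture over key sets; replacing it by the product law of
non-key scores can only increase the divergence, and then each of the `n` keys contributes exactly
`KL(μK ‖ μN)`. -/
theorem memoryBudget_tableTester_le (hn : 0 < n) (hu : n < u) :
    (tableTester μK μN u n).memoryBudget
      ≤ n * klBits (μK : Measure unitInterval) (μN : Measure unitInterval) := by
  have hp := isProbabilityMeasure_uniformOn_keySet (u := u) (n := n) hu.le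
  have hne := nonempty_keySet hu.le
  have hγ : IsProbabilityMeasure (tableJoint μK μN u n) := by
    unfold tableJoint; infer_instance
  rw [memoryBudget_tableTester]
  unfold mutualInfoBits klBits
  rw [← mul_div_assoc]
  refine ENNReal.div_le_div_right ?_ _
  by_cases htop : klDiv (μK : Measure unitInterval) (μN : Measure unitInterval) = ∞
  · rw [htop, ENNReal.mul_top (by exact_mod_cast hn.ne')]
    exact le_top
  obtain ⟨hac, hint⟩ := klDiv_ne_top_iff.1 htop
  refine (klDiv_prod_marginals_le _ (nonkeyTable μN u)).trans (le_of_eq ?_)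
  have hfst : (tableJoint μK μN u n).fst = uniformOn Set.univ := by
    unfold tableJoint; simp
  have hi := integrable_keyLlr hu hint
  rw [hfst, klDiv_withDensity (measurable_tableDensity μK μN) (tableJoint_eq_withDensity hac) hi
    (log_tableDensity_ae_eq hu hac)]
  have hval : ∫ q, keyLlr μK μN q ∂(tableJoint μK μN u n)
      = n * (klDiv (μK : Measure unitInterval) μN).toReal := by
    rw [toReal_klDiv_of_measure_eq hac (by simp)]
    unfold tableJoint at hi ⊢
    rw [Measure.integral_compProd hi]
    refine (integral_congr_ae (Eventually.of_forall fun K =>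
      integral_keyLlr_tableLaw hint K)).trans ?_
    simp
  rw [hval, ENNReal.ofReal_mul (Nat.cast_nonneg n), ENNReal.ofReal_natCast,
    ENNReal.ofReal_toReal htop]

end MembershipTester

/-! ### Assembly -/

theorem tendsto_succ_div_mul :
    Tendsto (fun j : ℕ => ((j + 1 : ℕ) : ℝ) / (((j + 1) * (j + 2) : ℕ) : ℝ)) atTop (𝓝 0) := by
  have h : (fun j : ℕ => ((j + 1 : ℕ) : ℝ) / (((j + 1) * (j + 2) : ℕ) : ℝ))
      = fun j : ℕ => (1 : ℝ) / (((j + 1 : ℕ) : ℝ) + 1) := by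
    funext j
    push_cast
    field_simp
    ring
  rw [h]
  exact (tendsto_one_div_add_atTop_nhds_zero_nat (𝕜 := ℝ)).comp (tendsto_add_atTop_nat 1)

theorem theorem3p1 (dK dN : unitInterval → ℝ≥0∞) (hd : AdmissibleErrors dK dN) (εK εN : ℝ≥0) :
    ∃ V : ℝ≥0∞,
      -- `V` is the minimum of `KL(μK ‖ μN)` over the feasible regions
      IsLeast {v : ℝ≥0∞ | ∃ μK ∈ feasible dK εK, ∃ μN ∈ feasible dN εN,
        v = klBits (μK : Measure unitInterval) (μN : Measure unitInterval)} V ∧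
      -- the lower bound
      (∀ (n u : ℕ → ℕ) (M : ∀ j, MembershipTester (u j) (n j)) (eK eN : ℕ → ℝ≥0∞),
        (∀ j, 0 < u j) →
        Tendsto n atTop atTop →
        Tendsto (fun j => (n j : ℝ) / (u j : ℝ)) atTop (𝓝 0) →
        (∀ j, (M j).PermInvariant) →
        (∀ j, (M j).AchievesError dK dN (eK j) (eN j)) →
        limsup eK atTop ≤ εK →
        limsup eN atTop ≤ εN →
        V ≤ liminf (fun j => (M j).memoryBudget / (n j : ℝ≥0∞)) atTop) ∧
      -- the lower bound is attained by some sequence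
      (∃ (n u : ℕ → ℕ) (M : ∀ j, MembershipTester (u j) (n j)) (eK eN : ℕ → ℝ≥0),
        (∀ j, 0 < n j ∧ n j < u j) ∧
        Tendsto n atTop atTop ∧
        Tendsto (fun j => (n j : ℝ) / (u j : ℝ)) atTop (𝓝 0) ∧
        (∀ j, (M j).PermInvariant) ∧
        (∀ j, (M j).AchievesError dK dN (eK j) (eN j)) ∧
        limsup (fun j => (eK j : ℝ≥0∞)) atTop ≤ εK ∧
        limsup (fun j => (eN j : ℝ≥0∞)) atTop ≤ εN ∧
        Tendsto (fun j => (M j).memoryBudget / (n j : ℝ≥0∞)) atTop (𝓝 V)) := by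
  obtain ⟨μK, hμK, μN, hμN, hmin⟩ := exists_klBits_minimizer hd εK εN
  refine ⟨klBits (μK : Measure unitInterval) (μN : Measure unitInterval),
    ⟨⟨μK, hμK, μN, hμN, rfl⟩, ?_⟩, ?_, ?_⟩
  · rintro v ⟨νK, hνK, νN, hνN, rfl⟩
    exact hmin νK hνK νN hνN
  · intro n u M eK eN hu hn hnu hM herr heK heN
    exact le_liminf_memoryBudget_div hd hmin hu hn hnu hM herr heK heN
  · have hlt : ∀ j : ℕ, j + 1 < (j + 1) * (j + 2) := fun j => by nlinarith
    have hn : Tendsto (fun j : ℕ => j + 1) atTop atTop := tendsto_add_atTop_nat 1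
    have hM : ∀ j : ℕ, (MembershipTester.tableTester μK μN ((j + 1) * (j + 2)) (j + 1)).PermInvariant :=
      fun j => MembershipTester.permInvariant_tableTester μK μN
    have herr : ∀ j : ℕ, (MembershipTester.tableTester μK μN ((j + 1) * (j + 2)) (j + 1)).AchievesError
        dK dN εK εN := fun j => by
      refine ⟨?_, ?_⟩
      · rw [MembershipTester.keyLaw_tableTester μK μN j.succ_pos (hlt j)]
        exact hμK
      · rw [MembershipTester.nonkeyLaw_tableTester μK μN (hlt j)]
        exact hμN
    -- The sizes give `n/u = 1/(j + 2)`, with `0 < n < u` at every index.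
    refine ⟨fun j => j + 1, fun j => (j + 1) * (j + 2), fun j =>
      MembershipTester.tableTester μK μN _ _, fun _ => εK, fun _ => εN,
      fun j => ⟨j.succ_pos, hlt j⟩, hn, tendsto_succ_div_mul, hM, herr, by simp, by simp, ?_⟩
    -- The lower half is the general converse applied to the table testers themselves; the upper
    -- half holds at every index.
    refine tendsto_of_le_liminf_of_limsup_le
      (le_liminf_memoryBudget_div (eK := fun _ => εK) (eN := fun _ => εN) hd hmin
        (fun j => (Nat.zero_le _).trans_lt (hlt j)) hn tendsto_succ_div_mul hM herr
        (by simp) (by simp)) ?_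
    refine (limsup_le_limsup (Eventually.of_forall fun j => ?_)).trans
      (limsup_const (klBits (μK : Measure unitInterval) (μN : Measure unitInterval))).le
    refine (ENNReal.div_le_iff (by simp) (ENNReal.natCast_ne_top _)).2 ?_
    rw [mul_comm]
    exact MembershipTester.memoryBudget_tableTester_le j.succ_pos (hlt j)
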